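/- For $q\in\mathbb R^3$ put $q_0=\sqrt{1+|q|^2}$. For $\beta>0$ let $M(\beta)=\int_{\mathbb R^3}e^{-\beta p_0}\,dp$ and $K_i(\beta)=\int_0^\infty\cosh(ir)\,e^{-\beta\cosh r}\,dr$ for $i=1,2$. For a non-negative $h\in L^1(\mathbb R^3)$, not a.e. zero, define $n_h>0$, $u_h\in\mathbb R^3$ and $\beta_h>0$ by $$n_h^2=\Big(\int h\,dq\Big)^2-\sum_{i=1}^3\Big(\int h\,\frac{q_i}{q_0}\,dq\Big)^2,\qquad n_hu_h=\int h\,\frac{q}{q_0}\,dq,\qquad \frac{K_1}{K_2}(\beta_h)=\frac1{n_h}\int h\,\frac{dq}{q_0},$$ and let $$J_h(q)=\frac{n_h}{M(\beta_h)}\,e^{-\beta_h\left(\sqrt{1+|u_h|^2}\sqrt{1+|q|^2}-u_h\cdot q\right)}.$$ Let $f_L,f_R:\mathbb R^3\to\mathbb R$ be such that $f_{LR}=f_L1_{q_1>0}+f_R1_{q_1<0}$ is non-negative and belongs to $L^1(\mathbb R^3)$. For $w>0$ and $x\in[0,1]$ put $$f^e_{LR}(x,q)=e^{-\frac{w}{|q_1|}x}f_L1_{q_1>0}+e^{-\frac{w}{|q_1|}(1-x)}f_R1_{q_1<0},$$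 $$a_l=\int e^{-\frac w{|q_1|}}f_{LR}\frac{dq}{q_0^2},\qquad a_u=2\int f_{LR}\,dq,\qquad \lambda(x)=\Big(\int f^e_{LR}\frac{dq}{q_0}\Big)\Big(\int f^e_{LR}\,dq\int f^e_{LR}\frac{dq}{q_0^2}\Big)^{-1/2},$$ and assume that $a_l>0$ (a condition that does not depend on the choice of $w>0$). Let $\Omega=\Omega_w$ be the set of all $f\in L^1([0,1]\times\mathbb R^3)$ such that $f\ge0$ and, for almost every $x\in[0,1]$, $$a_l\le\int f(x,q)\frac{dq}{q_0^2},\qquad \int f(x,q)\,dq\le a_u,\qquad \frac{K_1}{K_2}(\beta_{f(x,\cdot)})\le\sqrt{\lambda(x)}.$$ For $f\in\Omega$ and $x\in[0,1]$ let $$\Phi(f)(x,q)=\Big(e^{-\frac w{|q_1|}x}f_L(q)+\frac w{|q_1|}\int_0^xe^{-\frac w{|q_1|}(x-y)}J_{f(y,\cdot)}(q)\,dy\Big)1_{q_1>0}+\Big(e^{-\frac w{|q_1|}(1-x)}f_R(q)+\frac w{|q_1|}\int_x^1e^{-\frac w{|q_1|}(y-x)}J_{f(y,\cdot)}(q)\,dy\Big)1_{q_1<0}.$$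 **Proposition.** There is $\varepsilon>0$ such that for every $0<w<\varepsilon$ the operator $\Phi$ is a contraction mapping on $\Omega$: it maps $\Omega$ into $\Omega$, and there is a constant $0<\alpha<1$ such that for all $f,g\in\Omega$ $$\sup_{x\in[0,1]}\|\Phi(f)(x,\cdot)-\Phi(g)(x,\cdot)\|_{L^1_q}\le\alpha\ \operatorname*{ess\,sup}_{x\in[0,1]}\|f(x,\cdot)-g(x,\cdot)\|_{L^1_q},$$ where $\|h\|_{L^1_q}=\int_{\mathbb R^3}|h(q)|\,dq$. -/

import Mathlib

open MeasureTheory Set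

noncomputable section

namespace MarleBGK

/-- Momentum space `ℝ³` with its Euclidean norm. The coordinate `q₁` of the paper is `q 0`. -/
abbrev Mom : Type := EuclideanSpace ℝ (Fin 3)

/-- The relativistic energy `q₀ = √(1 + |q|²)`. -/
def energy (q : Mom) : ℝ := Real.sqrt (1 + ‖q‖ ^ 2)

/-- The modified Bessel function of the second kind,
`K_i(β) = ∫₀^∞ cosh (i r) exp (-β cosh r) dr`. -/
def besselK (i : ℕ) (β : ℝ) : ℝ :=
  ∫ r in Ioi (0 : ℝ), Real.cosh ((i : ℝ) * r) * Real.exp (-β * Real.cosh r)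

/-- The quotient `(K₁ / K₂)(β)`. -/
def besselRatio (β : ℝ) : ℝ := besselK 1 β / besselK 2 β

/-- `M(β) = ∫ exp (-β √(1 + |p|²)) dp`. -/
def maxwellMass (β : ℝ) : ℝ := ∫ p : Mom, Real.exp (-β * energy p)

/-- The particle flux `∫ h q / q₀ dq` of a momentum distribution `h`. -/
def flux (h : Mom → ℝ) : Mom := WithLp.toLp 2 fun i => ∫ q : Mom, h q * (q i / energy q)

/-- The proper particle density `n`, where `n² = (∫ h dq)² - ∑ᵢ (∫ h qᵢ / q₀ dq)²`. -/
def density (h : Mom → ℝ) : ℝ :=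
  Real.sqrt ((∫ q : Mom, h q) ^ 2 - ∑ i : Fin 3, flux h i ^ 2)

/-- The spatial part `u` of the velocity four-vector, where `n u = ∫ h q / q₀ dq`. -/
def velocity (h : Mom → ℝ) : Mom := (density h)⁻¹ • flux h

/-- The number `(1 / n) ∫ h / q₀ dq`. -/
def energyRatio (h : Mom → ℝ) : ℝ := (1 / density h) * ∫ q : Mom, h q * (1 / energy q)

/-- The inverse temperature `β > 0`, i.e. the solution in `(0, ∞)` of
`(K₁ / K₂)(β) = (1 / n) ∫ h / q₀ dq`. (It exists and is unique for every nonnegative integrable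
`h` that is not almost everywhere zero.) -/
def beta (h : Mom → ℝ) : ℝ := Function.invFunOn besselRatio (Ioi 0) (energyRatio h)

/-- The local relativistic Maxwellian
`J_h(q) = n / M(β) * exp (-β (√(1 + |u|²) √(1 + |q|²) - u · q))`. -/
def maxwellian (h : Mom → ℝ) (q : Mom) : ℝ :=
  density h / maxwellMass (beta h) *
    Real.exp (-beta h *
      (Real.sqrt (1 + ‖velocity h‖ ^ 2) * Real.sqrt (1 + ‖q‖ ^ 2) - inner ℝ (velocity h) q))

/-- The inflow data `f_LR = f_L 1_{q₁ > 0} + f_R 1_{q₁ < 0}`. -/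
def inflow (fL fR : Mom → ℝ) (q : Mom) : ℝ :=
  if 0 < q 0 then fL q else if q 0 < 0 then fR q else 0

/-- The damped inflow data
`f^e_LR = exp (-w x / |q₁|) f_L 1_{q₁ > 0} + exp (-w (1 - x) / |q₁|) f_R 1_{q₁ < 0}`. -/
def dampedInflow (fL fR : Mom → ℝ) (w x : ℝ) (q : Mom) : ℝ :=
  if 0 < q 0 then Real.exp (-(w / |q 0|) * x) * fL q
  else if q 0 < 0 then Real.exp (-(w / |q 0|) * (1 - x)) * fR q
  else 0

/-- `a_l = ∫ exp (-w / |q₁|) f_LR / q₀² dq`. -/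
def aLower (fL fR : Mom → ℝ) (w : ℝ) : ℝ :=
  ∫ q : Mom, Real.exp (-(w / |q 0|)) * inflow fL fR q * (1 / energy q ^ 2)

/-- `a_u = 2 ∫ f_LR dq`. -/
def aUpper (fL fR : Mom → ℝ) : ℝ := 2 * ∫ q : Mom, inflow fL fR q

/-- `λ = (∫ f^e_LR / q₀ dq) (∫ f^e_LR dq ∫ f^e_LR / q₀² dq)^(-1/2)`, which depends on `w` and on
the position `x` through `f^e_LR`. -/
def lam (fL fR : Mom → ℝ) (w x : ℝ) : ℝ :=
  (∫ q : Mom, dampedInflow fL fR w x q * (1 / energy q)) *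
    (Real.sqrt ((∫ q : Mom, dampedInflow fL fR w x q) *
      ∫ q : Mom, dampedInflow fL fR w x q * (1 / energy q ^ 2)))⁻¹

/-- Lebesgue measure on the slab `[0, 1]` of positions. -/
def slab : Measure ℝ := volume.restrict (Icc (0 : ℝ) 1)

/-- The solution space `Ω`: integrable functions on `[0, 1] × ℝ³` with property `(𝒜)` for almost
every `x`. Elements of `L¹` are represented by functions `f x q`, of which only the values at
almost every `(x, q)` in `[0, 1] × ℝ³` matter. -/
def solutionSpace (fL fR : Mom → ℝ) (w : ℝ) : Set (ℝ → Mom → ℝ) :=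
  {f | Integrable (Function.uncurry f) (slab.prod (volume : Measure Mom)) ∧
    ∀ᵐ x ∂slab,
      (∀ᵐ q : Mom, 0 ≤ f x q) ∧
      aLower fL fR w ≤ (∫ q : Mom, f x q * (1 / energy q ^ 2)) ∧
      (∫ q : Mom, f x q) ≤ aUpper fL fR ∧
      besselRatio (beta (f x)) ≤ Real.sqrt (lam fL fR w x)}

/-- The solution operator `Φ`. -/
def solutionOp (fL fR : Mom → ℝ) (w : ℝ) (f : ℝ → Mom → ℝ) (x : ℝ) (q : Mom) : ℝ :=
  if 0 < q 0 then
    Real.exp (-(w / |q 0|) * x) * fL q +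
      w / |q 0| * ∫ y in (0 : ℝ)..x, Real.exp (-(w / |q 0|) * (x - y)) * maxwellian (f y) q
  else if q 0 < 0 then
    Real.exp (-(w / |q 0|) * (1 - x)) * fR q +
      w / |q 0| * ∫ y in x..(1 : ℝ), Real.exp (-(w / |q 0|) * (y - x)) * maxwellian (f y) q
  else 0

/-- The distance `‖h - k‖_{L¹_q} = ∫ |h - k| dq` of two momentum distributions, as an extended
nonnegative number. -/
def distL1 (h k : Mom → ℝ) : ENNReal := ∫⁻ q : Mom, ENNReal.ofReal |h q - k q|

end MarleBGK

end

namespace MarleBGK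

/-! On the slab, `Φ(f)` is the damped inflow plus a gain term, the integral of the Maxwellians of
`f` against a transport kernel (`solutionOp_eq`). The kernel has total mass at most `1 - exp (-w /
|q₁|)`. If all Maxwellians in play lie below one integrable `G`, the gain therefore has mass at most
`∫ (1 - exp (-w / |q₁|)) G dq`. By dominated convergence this tends to `0` with `w`
(`tendsto_integral_scatter_mul`); no rate is needed. Both assertions of the theorem follow from the
smallness of this one integral.

The dominating function comes from compactness of the fluid parameters (`exists_maxwellian_bounds`).
Bounds `a ≤ ∫ h / q₀²` and `∫ h ≤ A` give `a ≤ n ≤ A` and `|u| ≤ A / a`. The elementary bounds `β /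
(β + 2) ≤ K₁ / K₂ ≤ β / 2`, together with `K₁ / K₂ ≤ s < 1`, keep `β` in a compact part of `(0, ∞)`.
There `K₁ / K₂` has derivative bounded below by a positive constant, so `β`, like `n` and `u`, is
Lipschitz in `h` for the `L¹` norm. Hence `J_h ≤ G` and `|J_h - J_k| ≤ G ‖h - k‖` with the same `G`.

These constants must not depend on `w`. For `w < 1` monotonicity gives `a_l(w) ≥ a_l(1)`. Strict
Cauchy-Schwarz for the undamped inflow makes the limiting value of `λ` less than `1`, so `λ(x) ≤ l <
1` for all small `w` and all `x` (`exists_lam_le`).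

For invariance of `Ω`, the lower bound is inherited from the damped inflow, and the factor `2` in
`a_u` leaves room for the gain. The third condition uses `n² ≥ ∫ h ∫ h / q₀²`, whence the energy
quotient of `Φ(f)` is at most `λ` plus a multiple of the gain mass. The gap `√λ - λ = √λ (1 - √λ)`
is bounded below, since `λ` stays away from both `0` and `1`, and it absorbs the error.

For the contraction the inflow terms cancel, and the Lipschitz bound on the Maxwellians leaves the
small integral as the contraction constant. -/

lemma integral_linear_comb₃ {α : Type*} [MeasurableSpace α] {μ : Measure α} {f g h : α → ℝ}
    (hf : Integrable f μ) (hg : Integrable g μ) (hh : Integrable h μ) (a b c : ℝ) :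
    Integrable (fun x => a * f x + b * g x + c * h x) μ ∧
    ∫ x, (a * f x + b * g x + c * h x) ∂μ
      = a * ∫ x, f x ∂μ + b * ∫ x, g x ∂μ + c * ∫ x, h x ∂μ := by
  have hfg : Integrable (fun x => a * f x + b * g x) μ := (hf.const_mul a).add (hg.const_mul b)
  refine ⟨hfg.add (hh.const_mul c), ?_⟩
  rw [integral_add hfg (hh.const_mul c), integral_add (hf.const_mul a) (hg.const_mul b),
    integral_const_mul, integral_const_mul, integral_const_mul]

/-! ### Bessel functions -/

/-- The moment `∫₀^∞ cosh^k r exp (-b cosh r) dr`. -/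
noncomputable def coshMoment (k : ℕ) (b : ℝ) : ℝ :=
  ∫ r in Ioi (0 : ℝ), Real.cosh r ^ k * Real.exp (-b * Real.cosh r)

/-- A single term of the exponential series is at most the whole series. -/
lemma pow_mul_exp_neg_le {b x : ℝ} (hb : 0 < b) (hx : 0 ≤ x) (n : ℕ) :
    x ^ n * Real.exp (-b * x) ≤ n.factorial / b ^ n := by
  have h := Real.pow_div_factorial_le_exp (b * x) (by positivity) n
  have hf : (0 : ℝ) < n.factorial := by exact_mod_cast n.factorial_pos
  rw [div_le_iff₀ hf, mul_pow] at h
  rw [le_div_iff₀ (by positivity), neg_mul, Real.exp_neg, mul_assoc, mul_comm, mul_assoc,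
    inv_mul_le_iff₀ (Real.exp_pos _)]
  linarith

lemma one_add_sq_le_four_mul_cosh (r : ℝ) : 1 + r ^ 2 ≤ 4 * Real.cosh r := by
  rw [← Real.cosh_abs, ← sq_abs]
  have h := Real.quadratic_le_exp_of_nonneg (abs_nonneg r)
  rw [Real.cosh_eq]
  have := Real.exp_pos (-|r|)
  nlinarith [abs_nonneg r]

/-- One extra power of `cosh r` is still absorbed by the exponential, and the remaining `1 / cosh r`
is at most `4 / (1 + r ^ 2)`. -/
lemma integrable_coshMoment (k : ℕ) {b : ℝ} (hb : 0 < b) :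
    Integrable (fun r => Real.cosh r ^ k * Real.exp (-b * Real.cosh r)) := by
  refine (integrable_inv_one_add_sq.const_mul (4 * ((k + 1).factorial / b ^ (k + 1)))).mono'
    (by fun_prop) (Filter.Eventually.of_forall fun r => ?_)
  have hc : 0 < Real.cosh r := Real.cosh_pos r
  rw [Real.norm_of_nonneg (by positivity)]
  have h1 := pow_mul_exp_neg_le hb hc.le (k + 1)
  have h2 := one_add_sq_le_four_mul_cosh r
  have h3 : (Real.cosh r)⁻¹ ≤ 4 * (1 + r ^ 2)⁻¹ := by
    rw [inv_le_comm₀ hc (by positivity), mul_inv, inv_inv]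
    linarith
  calc Real.cosh r ^ k * Real.exp (-b * Real.cosh r)
      = (Real.cosh r ^ (k + 1) * Real.exp (-b * Real.cosh r)) * (Real.cosh r)⁻¹ := by
        rw [pow_succ]
        field_simp
    _ ≤ ((k + 1).factorial / b ^ (k + 1)) * (4 * (1 + r ^ 2)⁻¹) := by gcongr
    _ = _ := by ring

lemma hasDerivAt_coshMoment (k : ℕ) {b : ℝ} (hb : 0 < b) :
    HasDerivAt (coshMoment k) (-coshMoment (k + 1) b) b := by
  -- Parameters above `b / 2` form a neighbourhood of `b` on which the integrand with parameter `b /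
  -- 2` dominates the derivatives.
  have h := hasDerivAt_integral_of_dominated_loc_of_deriv_le
    (μ := volume.restrict (Ioi (0 : ℝ))) (s := Ioi (b / 2)) (x₀ := b)
    (F := fun x r => Real.cosh r ^ k * Real.exp (-x * Real.cosh r))
    (F' := fun x r => -(Real.cosh r ^ (k + 1) * Real.exp (-x * Real.cosh r)))
    (bound := fun r => Real.cosh r ^ (k + 1) * Real.exp (-(b / 2) * Real.cosh r))
    (Ioi_mem_nhds (by linarith))
    (Filter.Eventually.of_forall fun x => by fun_prop)
    (integrable_coshMoment k hb).integrableOn (by fun_prop)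
    (Filter.Eventually.of_forall fun r x hx => by
      have hc := Real.cosh_pos r
      rw [norm_neg, Real.norm_of_nonneg (by positivity)]
      have : b / 2 ≤ x := le_of_lt hx
      gcongr)
    (integrable_coshMoment (k + 1) (by linarith)).integrableOn
    (Filter.Eventually.of_forall fun r x _ => by
      have h1 : HasDerivAt (fun x : ℝ => -x * Real.cosh r) (-1 * Real.cosh r) x :=
        (hasDerivAt_id x).neg.mul_const _
      refine (h1.exp.const_mul (Real.cosh r ^ k)).congr_deriv ?_
      ring)
  have h2 := h.2
  rw [integral_neg] at h2
  exact h2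

lemma besselK_one (b : ℝ) : besselK 1 b = coshMoment 1 b := by
  simp [besselK, coshMoment]

lemma besselK_two {b : ℝ} (hb : 0 < b) :
    besselK 2 b = 2 * coshMoment 2 b - coshMoment 0 b := by
  rw [besselK, coshMoment, coshMoment, ← integral_const_mul, ← integral_sub
    ((integrable_coshMoment 2 hb).integrableOn.const_mul 2)
    (integrable_coshMoment 0 hb).integrableOn]
  congr 1 with r
  push_cast
  rw [Real.cosh_two_mul, Real.sinh_sq]
  ring

lemma coshMoment_pos (k : ℕ) {b : ℝ} (hb : 0 < b) : 0 < coshMoment k b := by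
  rw [coshMoment, setIntegral_pos_iff_support_of_nonneg_ae
    (Filter.Eventually.of_forall fun r => by have := Real.cosh_pos r; positivity)
    (integrable_coshMoment k hb).integrableOn]
  have : Function.support (fun r => Real.cosh r ^ k * Real.exp (-b * Real.cosh r)) = univ := by
    ext r
    have := Real.cosh_pos r
    simp only [Function.mem_support, mem_univ, iff_true]
    positivity
  rw [this]
  simp

lemma coshMoment_le_succ (k : ℕ) {b : ℝ} (hb : 0 < b) :
    coshMoment k b ≤ coshMoment (k + 1) b := by
  refine integral_mono (integrable_coshMoment k hb).integrableOn
    (integrable_coshMoment (k + 1) hb).integrableOn fun r => ?_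
  have := pow_le_pow_right₀ (Real.one_le_cosh r) (Nat.le_succ k)
  have := Real.exp_pos (-b * Real.cosh r)
  simp only
  gcongr

/-- Integration by parts. -/
lemma coshMoment_one_eq {b : ℝ} (hb : 0 < b) :
    coshMoment 1 b = b * (coshMoment 2 b - coshMoment 0 b) := by
  have i0 := (integrable_coshMoment 0 hb).integrableOn (s := Ioi 0)
  have i1 := (integrable_coshMoment 1 hb).integrableOn (s := Ioi 0)
  have i2 := (integrable_coshMoment 2 hb).integrableOn (s := Ioi 0)
  have hlim : Filter.Tendsto (fun r => Real.sinh r * Real.exp (-b * Real.cosh r))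
      Filter.atTop (nhds 0) := by
    have h4 : Filter.Tendsto (fun r : ℝ => 8 / b ^ 2 * r⁻¹) Filter.atTop (nhds 0) := by
      have := (tendsto_inv_atTop_zero (𝕜 := ℝ)).const_mul (8 / b ^ 2)
      rwa [mul_zero] at this
    refine tendsto_of_tendsto_of_tendsto_of_le_of_le' tendsto_const_nhds h4 ?_ ?_
    · filter_upwards [Filter.eventually_ge_atTop 0] with r hr
      have := Real.sinh_nonneg_iff.2 hr
      positivity
    · filter_upwards [Filter.eventually_gt_atTop 0] with r hr
      have hc := Real.cosh_pos r
      have h1 := pow_mul_exp_neg_le hb hc.le 2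
      have h2 := one_add_sq_le_four_mul_cosh r
      have h3 := Real.sinh_lt_cosh r
      have hE := Real.exp_pos (-b * Real.cosh r)
      have h5 : Real.cosh r * Real.exp (-b * Real.cosh r) * r ≤ 8 / b ^ 2 := by
        have : ((2 : ℕ).factorial : ℝ) = 2 := by norm_num
        rw [this] at h1
        have h6 : r ≤ 4 * Real.cosh r := by nlinarith [sq_nonneg (r - 1)]
        calc Real.cosh r * Real.exp (-b * Real.cosh r) * r
            ≤ Real.cosh r * Real.exp (-b * Real.cosh r) * (4 * Real.cosh r) := by gcongr
          _ = 4 * (Real.cosh r ^ 2 * Real.exp (-b * Real.cosh r)) := by ring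
          _ ≤ 4 * (2 / b ^ 2) := by gcongr
          _ = _ := by ring
      rw [← div_eq_mul_inv, le_div_iff₀ hr]
      refine le_trans ?_ h5
      gcongr
  -- The derivative of `sinh r * exp (-b * cosh r)` is `(b + cosh r - b * cosh r ^ 2) * exp (-b *
  -- cosh r)`, by `sinh ^ 2 = cosh ^ 2 - 1`; this fixes the coefficients.
  obtain ⟨hint, hval⟩ := integral_linear_comb₃ i0 i1 i2 b 1 (-b)
  have key := integral_Ioi_of_hasDerivAt_of_tendsto
    (f := fun r => Real.sinh r * Real.exp (-b * Real.cosh r)) (a := 0) (m := 0)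
    (by fun_prop) (fun r _ => by
      have h1 : HasDerivAt (fun r : ℝ => -b * Real.cosh r) (-b * Real.sinh r) r :=
        (Real.hasDerivAt_cosh r).const_mul _
      refine ((Real.hasDerivAt_sinh r).mul h1.exp).congr_deriv ?_
      have := Real.sinh_sq r
      linear_combination (-(b * Real.exp (-b * Real.cosh r))) * this) hint hlim
  rw [hval] at key
  simp only [Real.sinh_zero, zero_mul, sub_zero] at key
  unfold coshMoment
  linarith

lemma besselK_two_pos {b : ℝ} (hb : 0 < b) : 0 < besselK 2 b := by
  rw [besselK_two hb]
  have := coshMoment_pos 2 hb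
  have := coshMoment_le_succ 0 hb
  have := coshMoment_le_succ 1 hb
  norm_num at *
  linarith

/-- With moments `cₖ`, integration by parts turns the quotient into `b (c₂ - c₀) / (2 c₂ - c₀)`, and
`c₀ > 0`. This bound later keeps `β` away from `0`. -/
lemma besselRatio_le_half {b : ℝ} (hb : 0 < b) : besselRatio b ≤ b / 2 := by
  have h := besselK_two_pos hb
  rw [besselRatio, div_le_iff₀ h, besselK_one, besselK_two hb, coshMoment_one_eq hb]
  have := coshMoment_pos 0 hb
  nlinarith

/-- Integration by parts gives `b (2 c₂ - c₀) = 2 c₁ + b c₀`, which is at most `(2 + b) c₁`. This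
bound later keeps `β` away from `∞`. -/
lemma div_add_two_le_besselRatio {b : ℝ} (hb : 0 < b) : b / (b + 2) ≤ besselRatio b := by
  have h := besselK_two_pos hb
  have h01 := coshMoment_le_succ 0 hb
  have h1 := coshMoment_one_eq hb
  rw [besselRatio, div_le_div_iff₀ (by linarith) h, besselK_one, besselK_two hb]
  norm_num at h01
  nlinarith

/-! ### Strict monotonicity of the Bessel quotient -/

lemma sq_lt_mul_of_forall_pos {x y z : ℝ} (hz : 0 < z)
    (h : ∀ t : ℝ, 0 < x - 2 * t * y + t ^ 2 * z) : y ^ 2 < x * z := by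
  -- The minimiser of the quadratic in `t`.
  have h1 := h (y / z)
  have : x - 2 * (y / z) * y + (y / z) ^ 2 * z = (x * z - y ^ 2) / z := by
    field_simp
    ring
  rw [this] at h1
  have := (div_pos_iff_of_pos_right hz).1 h1
  linarith

/-- Cauchy-Schwarz, strict because `1 - t * cosh r` vanishes for at most one `r > 0` and so the
integral of its weighted square is positive. -/
lemma coshMoment_sq_lt (k : ℕ) {b : ℝ} (hb : 0 < b) :
    coshMoment (k + 1) b ^ 2 < coshMoment k b * coshMoment (k + 2) b := by
  refine sq_lt_mul_of_forall_pos (coshMoment_pos _ hb) fun t => ?_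
  have i0 := (integrable_coshMoment k hb).integrableOn (s := Ioi 0)
  have i1 := (integrable_coshMoment (k + 1) hb).integrableOn (s := Ioi 0)
  have i2 := (integrable_coshMoment (k + 2) hb).integrableOn (s := Ioi 0)
  obtain ⟨i3, hval⟩ := integral_linear_comb₃ i0 i1 i2 1 (-(2 * t)) (t ^ 2)
  have e : ∀ r, 1 * (Real.cosh r ^ k * Real.exp (-b * Real.cosh r))
      + -(2 * t) * (Real.cosh r ^ (k + 1) * Real.exp (-b * Real.cosh r))
      + t ^ 2 * (Real.cosh r ^ (k + 2) * Real.exp (-b * Real.cosh r))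
      = Real.cosh r ^ k * Real.exp (-b * Real.cosh r) * (1 - t * Real.cosh r) ^ 2 := by
    intro r; ring
  have : coshMoment k b - 2 * t * coshMoment (k + 1) b + t ^ 2 * coshMoment (k + 2) b =
      ∫ r in Ioi (0 : ℝ), (1 * (Real.cosh r ^ k * Real.exp (-b * Real.cosh r))
      + -(2 * t) * (Real.cosh r ^ (k + 1) * Real.exp (-b * Real.cosh r))
      + t ^ 2 * (Real.cosh r ^ (k + 2) * Real.exp (-b * Real.cosh r))) := by
    rw [hval]
    simp only [coshMoment]
    ring
  rw [this, setIntegral_pos_iff_support_of_nonneg_ae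
    (Filter.Eventually.of_forall fun r => by
      have := Real.cosh_pos r
      simp only [e, Pi.zero_apply]
      positivity) i3]
  have hsub : ({r : ℝ | 0 < r ∧ 1 - t * Real.cosh r = 0}).Subsingleton := by
    rintro r ⟨hr, h1⟩ s ⟨hs, h2⟩
    have ht : t ≠ 0 := by rintro rfl; simp at h1
    have : Real.cosh r = Real.cosh s := by
      apply mul_left_cancel₀ ht; linarith
    exact Real.cosh_strictMonoOn.injOn hr.le hs.le this
  have hnull : volume {r : ℝ | 0 < r ∧ 1 - t * Real.cosh r = 0} = 0 :=
    hsub.finite.measure_zero _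
  have hsup : Ioi (0 : ℝ) \ {r : ℝ | 0 < r ∧ 1 - t * Real.cosh r = 0} ⊆
      Function.support (fun r => 1 * (Real.cosh r ^ k * Real.exp (-b * Real.cosh r))
      + -(2 * t) * (Real.cosh r ^ (k + 1) * Real.exp (-b * Real.cosh r))
      + t ^ 2 * (Real.cosh r ^ (k + 2) * Real.exp (-b * Real.cosh r))) ∩ Ioi 0 := by
    rintro r ⟨hr, h⟩
    refine ⟨?_, hr⟩
    have hne : 1 - t * Real.cosh r ≠ 0 := fun h' => h ⟨hr, h'⟩
    have := Real.cosh_pos r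
    rw [Function.mem_support, e]
    positivity
  refine lt_of_lt_of_le ?_ (measure_mono hsup)
  rw [measure_sdiff_null hnull]
  simp

/-- The derivative of the ratio of Bessel functions. -/
noncomputable def besselRatioDeriv (b : ℝ) : ℝ :=
  (2 * (coshMoment 1 b * coshMoment 3 b - coshMoment 2 b ^ 2)
    + (coshMoment 0 b * coshMoment 2 b - coshMoment 1 b ^ 2))
    / (2 * coshMoment 2 b - coshMoment 0 b) ^ 2

/-- Both brackets in the numerator are strict Cauchy-Schwarz gaps between consecutive moments. -/
lemma besselRatioDeriv_pos {b : ℝ} (hb : 0 < b) : 0 < besselRatioDeriv b := by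
  have h1 := coshMoment_sq_lt 1 hb
  have h2 := coshMoment_sq_lt 0 hb
  have h3 := besselK_two_pos hb
  rw [besselK_two hb] at h3
  norm_num at h1 h2
  unfold besselRatioDeriv
  have : 0 < 2 * (coshMoment 1 b * coshMoment 3 b - coshMoment 2 b ^ 2)
    + (coshMoment 0 b * coshMoment 2 b - coshMoment 1 b ^ 2) := by linarith
  positivity

lemma hasDerivAt_besselRatio {b : ℝ} (hb : 0 < b) :
    HasDerivAt besselRatio (besselRatioDeriv b) b := by
  have h3 := besselK_two_pos hb
  rw [besselK_two hb] at h3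
  have h := (hasDerivAt_coshMoment 1 hb).div
    (((hasDerivAt_coshMoment 2 hb).const_mul 2).sub (hasDerivAt_coshMoment 0 hb)) h3.ne'
  refine (h.congr_deriv ?_).congr_of_eventuallyEq ?_
  · simp only [besselRatioDeriv, Pi.sub_apply]
    congr 1
    norm_num
    ring
  · filter_upwards [Ioi_mem_nhds hb] with x hx
    rw [besselRatio, besselK_one, besselK_two hx]
    rfl

lemma continuousOn_coshMoment (k : ℕ) : ContinuousOn (coshMoment k) (Ioi 0) :=
  fun _ hb => (hasDerivAt_coshMoment k hb).continuousAt.continuousWithinAt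

lemma continuousOn_besselRatioDeriv : ContinuousOn besselRatioDeriv (Ioi 0) := by
  have h0 := continuousOn_coshMoment 0
  have h1 := continuousOn_coshMoment 1
  have h2 := continuousOn_coshMoment 2
  have h3 := continuousOn_coshMoment 3
  refine ContinuousOn.div (by fun_prop) (by fun_prop) fun b hb => ?_
  have := besselK_two_pos hb
  rw [besselK_two hb] at this
  positivity

lemma continuousOn_besselRatio : ContinuousOn besselRatio (Ioi 0) :=
  fun _ hb => (hasDerivAt_besselRatio hb).continuousAt.continuousWithinAt

lemma strictMonoOn_besselRatio : StrictMonoOn besselRatio (Ioi 0) := by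
  refine strictMonoOn_of_deriv_pos (convex_Ioi 0) continuousOn_besselRatio fun b hb => ?_
  rw [interior_Ioi] at hb
  rw [(hasDerivAt_besselRatio hb).deriv]
  exact besselRatioDeriv_pos hb

/-- Intermediate values: the endpoints `2 * ρ` and `2 * ρ / (1 - ρ)` are where the upper bound `b /
2` and the lower bound `b / (b + 2)` equal `ρ`. -/
lemma exists_besselRatio_eq {ρ : ℝ} (h0 : 0 < ρ) (h1 : ρ < 1) :
    ∃ b ∈ Ioi (0 : ℝ), besselRatio b = ρ := by
  have hb : 0 < 2 * ρ / (1 - ρ) := div_pos (by linarith) (by linarith)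
  have hlow := besselRatio_le_half (b := 2 * ρ) (by linarith)
  have hhigh := div_add_two_le_besselRatio hb
  have e : 2 * ρ / (1 - ρ) / (2 * ρ / (1 - ρ) + 2) = ρ := by
    have : 1 - ρ ≠ 0 := by linarith
    field_simp
    ring
  rw [e] at hhigh
  exact isPreconnected_Ioi.intermediate_value (mem_Ioi.2 (by linarith : (0 : ℝ) < 2 * ρ))
    (mem_Ioi.2 hb) continuousOn_besselRatio ⟨by linarith, hhigh⟩

/-- The inverse of the ratio of Bessel functions is Lipschitz on compact sets. -/
lemma exists_mul_abs_le_besselRatio {b₁ b₂ : ℝ} (hb₁ : 0 < b₁) :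
    ∃ c > 0, ∀ x ∈ Icc b₁ b₂, ∀ y ∈ Icc b₁ b₂,
      c * |x - y| ≤ |besselRatio x - besselRatio y| := by
  rcases (Icc b₁ b₂).eq_empty_or_nonempty with he | hne
  · exact ⟨1, one_pos, by simp [he]⟩
  have hsub : Icc b₁ b₂ ⊆ Ioi 0 := fun x hx => lt_of_lt_of_le hb₁ hx.1
  obtain ⟨m, hm, hmin⟩ := isCompact_Icc.exists_isMinOn hne (continuousOn_besselRatioDeriv.mono hsub)
  have hpos := besselRatioDeriv_pos (hsub hm)
  have key : ∀ x ∈ Icc b₁ b₂, ∀ y ∈ Icc b₁ b₂, x ≤ y →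
      besselRatioDeriv m * (y - x) ≤ besselRatio y - besselRatio x := by
    refine (convex_Icc b₁ b₂).mul_sub_le_image_sub_of_le_deriv
      (continuousOn_besselRatio.mono hsub) (fun x hx => ?_) fun x hx => ?_
    · exact (hasDerivAt_besselRatio
        (hsub (interior_subset hx))).differentiableAt.differentiableWithinAt
    · rw [(hasDerivAt_besselRatio (hsub (interior_subset hx))).deriv]
      exact hmin (interior_subset hx)
  refine ⟨_, hpos, fun x hx y hy => ?_⟩
  rcases le_total x y with h | h
  · rw [abs_sub_comm, abs_of_nonneg (sub_nonneg.2 h), abs_sub_comm]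
    exact (key x hx y hy h).trans (le_abs_self _)
  · rw [abs_of_nonneg (sub_nonneg.2 h)]
    exact (key y hy x hx h).trans (le_abs_self _)

/-! ### Moments of momentum distributions -/

lemma one_le_energy (q : Mom) : 1 ≤ energy q :=
  Real.one_le_sqrt.2 (by nlinarith [sq_nonneg ‖q‖])

lemma energy_pos (q : Mom) : 0 < energy q := one_pos.trans_le (one_le_energy q)

lemma energy_sq (q : Mom) : energy q ^ 2 = 1 + ‖q‖ ^ 2 := Real.sq_sqrt (by positivity)

lemma norm_le_energy (q : Mom) : ‖q‖ ≤ energy q :=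
  Real.le_sqrt_of_sq_le (by linarith)

@[fun_prop]
lemma continuous_energy : Continuous energy := by
  unfold energy
  fun_prop

lemma sum_div_energy_sq (q : Mom) : ∑ i : Fin 3, (q i / energy q) ^ 2 = 1 - 1 / energy q ^ 2 := by
  have h := energy_sq q
  have h2 := EuclideanSpace.real_norm_sq_eq q
  have h3 := energy_pos q
  simp only [div_pow]
  rw [← Finset.sum_div, ← h2]
  field_simp
  linarith

lemma abs_div_energy_le_one (q : Mom) (i : Fin 3) : |q i / energy q| ≤ 1 := by
  rw [abs_div, abs_of_pos (energy_pos q), div_le_one (energy_pos q)]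
  exact (PiLp.norm_apply_le q i).trans (norm_le_energy q)

lemma continuous_div_energy (i : Fin 3) : Continuous fun q : Mom => q i / energy q :=
  Continuous.div (by fun_prop) (by fun_prop) fun q => (energy_pos q).ne'

lemma continuous_one_div_energy : Continuous fun q : Mom => 1 / energy q :=
  Continuous.div (by fun_prop) (by fun_prop) fun q => (energy_pos q).ne'

lemma continuous_one_div_energy_sq : Continuous fun q : Mom => 1 / energy q ^ 2 :=
  Continuous.div (by fun_prop) (by fun_prop) fun q => (pow_pos (energy_pos q) 2).ne'

lemma one_div_energy_le_one (q : Mom) : 1 / energy q ≤ 1 :=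
  (div_le_one (energy_pos q)).2 (one_le_energy q)

lemma one_div_energy_pos (q : Mom) : 0 < 1 / energy q := one_div_pos.2 (energy_pos q)

lemma one_div_energy_sq_pos (q : Mom) : 0 < 1 / energy q ^ 2 :=
  one_div_pos.2 (pow_pos (energy_pos q) 2)

lemma one_div_energy_sq_le (q : Mom) : 1 / energy q ^ 2 ≤ 1 / energy q :=
  one_div_le_one_div_of_le (energy_pos q) (by nlinarith [one_le_energy q])

lemma abs_one_div_energy_le_one (q : Mom) : |1 / energy q| ≤ 1 := by
  rw [abs_of_pos (one_div_energy_pos q)]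
  exact one_div_energy_le_one q

lemma abs_one_div_energy_sq_le_one (q : Mom) : |1 / energy q ^ 2| ≤ 1 := by
  rw [abs_of_pos (one_div_energy_sq_pos q)]
  exact (one_div_energy_sq_le q).trans (one_div_energy_le_one q)

/-! ### Moment inequalities and Cauchy-Schwarz -/

variable {h k φ : Mom → ℝ}

lemma integrable_mul_of_abs_le_one (hh : Integrable h) (hφ : Continuous φ) (hb : ∀ q, |φ q| ≤ 1) :
    Integrable fun q => h q * φ q :=
  hh.mono (hh.1.mul hφ.aestronglyMeasurable) (Filter.Eventually.of_forall fun q => by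
    rw [norm_mul]
    exact mul_le_of_le_one_right (norm_nonneg _) (hb q))

lemma integrable_mul_one_div_energy (hh : Integrable h) :
    Integrable fun q => h q * (1 / energy q) :=
  integrable_mul_of_abs_le_one hh continuous_one_div_energy abs_one_div_energy_le_one

lemma integrable_mul_one_div_energy_sq (hh : Integrable h) :
    Integrable fun q => h q * (1 / energy q ^ 2) :=
  integrable_mul_of_abs_le_one hh continuous_one_div_energy_sq abs_one_div_energy_sq_le_one

lemma abs_integral_mul_sub_le (hh : Integrable h) (hk : Integrable k) (hφ : Continuous φ)
    (hb : ∀ q, |φ q| ≤ 1) :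
    |(∫ q, h q * φ q) - ∫ q, k q * φ q| ≤ ∫ q, |h q - k q| := by
  rw [← integral_sub (integrable_mul_of_abs_le_one hh hφ hb)
    (integrable_mul_of_abs_le_one hk hφ hb)]
  refine abs_integral_le_integral_abs.trans (integral_mono_of_nonneg
    (Filter.Eventually.of_forall fun _ => abs_nonneg _) (hh.sub hk).abs
    (Filter.Eventually.of_forall fun q => ?_))
  simp only [← sub_mul, abs_mul]
  exact mul_le_of_le_one_right (abs_nonneg _) (hb q)

lemma abs_integral_mul_le (hh : Integrable h) (h0 : 0 ≤ᵐ[volume] h)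
    (hb : ∀ q, |φ q| ≤ 1) : |∫ q, h q * φ q| ≤ ∫ q, h q := by
  refine abs_integral_le_integral_abs.trans (integral_mono_of_nonneg
    (Filter.Eventually.of_forall fun _ => abs_nonneg _) hh ?_)
  filter_upwards [h0] with q hq
  rw [abs_mul, abs_of_nonneg hq]
  exact mul_le_of_le_one_right hq (hb q)

lemma integral_mul_sq_eq (hh : Integrable h) (hφ : Continuous φ) (hb : ∀ q, |φ q| ≤ 1) (t : ℝ) :
    Integrable (fun q => h q * (1 - t * φ q) ^ 2) ∧
    ∫ q, h q * (1 - t * φ q) ^ 2 =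
      (∫ q, h q) - 2 * t * (∫ q, h q * φ q) + t ^ 2 * ∫ q, h q * φ q ^ 2 := by
  have hb2 : ∀ q, |φ q ^ 2| ≤ 1 := fun q => by
    rw [abs_pow]; exact pow_le_one₀ (abs_nonneg _) (hb q)
  obtain ⟨h1, h2⟩ := integral_linear_comb₃ hh (integrable_mul_of_abs_le_one hh hφ hb)
    (integrable_mul_of_abs_le_one (φ := fun q => φ q ^ 2) hh (hφ.pow 2) hb2) 1 (-(2 * t)) (t ^ 2)
  have e : (fun q => h q * (1 - t * φ q) ^ 2) =
      fun q => 1 * h q + -(2 * t) * (h q * φ q) + t ^ 2 * (h q * φ q ^ 2) := by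
    ext q; ring
  simp only [e]
  refine ⟨h1, ?_⟩
  rw [h2]
  ring

lemma sq_le_mul_of_forall_nonneg {x y z : ℝ}
    (h : ∀ t : ℝ, 0 ≤ x - 2 * t * y + t ^ 2 * z) : y ^ 2 ≤ x * z := by
  have := discrim_le_zero (a := z) (b := -2 * y) (c := x) fun t => by
    have := h t
    nlinarith
  unfold discrim at this
  nlinarith

/-- The Cauchy-Schwarz inequality with a nonnegative weight. -/
lemma integral_mul_sq_le (hh : Integrable h) (h0 : 0 ≤ᵐ[volume] h) (hφ : Continuous φ)
    (hb : ∀ q, |φ q| ≤ 1) :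
    (∫ q, h q * φ q) ^ 2 ≤ (∫ q, h q) * ∫ q, h q * φ q ^ 2 := by
  refine sq_le_mul_of_forall_nonneg fun t => ?_
  rw [← (integral_mul_sq_eq hh hφ hb t).2]
  refine integral_nonneg_of_ae ?_
  filter_upwards [h0] with q hq
  exact mul_nonneg hq (sq_nonneg _)

lemma integral_one_div_energy_sq_le (hh : Integrable h) (h0 : 0 ≤ᵐ[volume] h) :
    ∫ q, h q * (1 / energy q ^ 2) ≤ ∫ q, h q * (1 / energy q) := by
  refine integral_mono_ae (integrable_mul_one_div_energy_sq hh)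
    (integrable_mul_one_div_energy hh) ?_
  filter_upwards [h0] with q hq
  exact mul_le_mul_of_nonneg_left (one_div_energy_sq_le q) hq

lemma integral_one_div_energy_le (hh : Integrable h) (h0 : 0 ≤ᵐ[volume] h) :
    ∫ q, h q * (1 / energy q) ≤ ∫ q, h q :=
  (le_abs_self _).trans (abs_integral_mul_le hh h0 abs_one_div_energy_le_one)

/-- The equality case of Cauchy-Schwarz lives on a level set of the energy, which lies in a sphere.
-/
lemma volume_one_sub_mul_one_div_energy_eq_zero (t : ℝ) :
    volume {q : Mom | 1 - t * (1 / energy q) = 0} = 0 := by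
  refine measure_mono_null (fun q hq => ?_)
    (Measure.addHaar_sphere volume (0 : Mom) (Real.sqrt (t ^ 2 - 1)))
  have h1 : energy q = t := by
    have := energy_pos q
    simp only [mem_ofPred_eq] at hq
    field_simp at hq
    linarith
  rw [mem_sphere_zero_iff_norm, ← h1, energy_sq]
  simp

/-- The strict Cauchy-Schwarz inequality for the energy moments. -/
lemma integral_one_div_energy_sq_lt (hh : Integrable h) (h0 : 0 ≤ᵐ[volume] h)
    (hpos : 0 < ∫ q, h q * (1 / energy q ^ 2)) :
    (∫ q, h q * (1 / energy q)) ^ 2 < (∫ q, h q) * ∫ q, h q * (1 / energy q ^ 2) := by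
  have e : ∀ q : Mom, 1 / energy q ^ 2 = (1 / energy q) ^ 2 := fun q => by
    rw [div_pow, one_pow]
  refine sq_lt_mul_of_forall_pos hpos fun t => ?_
  have h1 := integral_mul_sq_eq hh continuous_one_div_energy abs_one_div_energy_le_one t
  simp only [e]
  rw [← h1.2]
  have hnn : 0 ≤ᵐ[volume] fun q => h q * (1 - t * (1 / energy q)) ^ 2 := by
    filter_upwards [h0] with q hq
    exact mul_nonneg hq (sq_nonneg _)
  refine (integral_nonneg_of_ae hnn).lt_of_ne fun hzero => ?_
  have h2 := (integral_eq_zero_iff_of_nonneg_ae hnn h1.1).1 hzero.symm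
  have hnull : ∀ᵐ q : Mom, 1 - t * (1 / energy q) ≠ 0 :=
    measure_eq_zero_iff_ae_notMem.1 (volume_one_sub_mul_one_div_energy_eq_zero t)
  have h3 : ∀ᵐ q : Mom, h q * (1 / energy q ^ 2) = 0 := by
    filter_upwards [h2, hnull] with q hq hn
    have : h q = 0 := (mul_eq_zero.1 hq).resolve_right (pow_ne_zero 2 hn)
    rw [this, zero_mul]
  rw [integral_congr_ae h3] at hpos
  simp at hpos

/-- Weighted Cauchy-Schwarz bounds each flux component, and summing with `|q|² / q₀² = 1 - 1 / q₀²`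
gives `|flux|² ≤ ∫ h (∫ h - ∫ h / q₀²)`. This bounds `n` below without any control of the direction
of the flux. -/
lemma integral_mul_le_sub_flux_sq (hh : Integrable h) (h0 : 0 ≤ᵐ[volume] h) :
    (∫ q, h q) * (∫ q, h q * (1 / energy q ^ 2)) ≤ (∫ q, h q) ^ 2 - ∑ i : Fin 3, flux h i ^ 2 := by
  have h1 : ∀ i : Fin 3, flux h i ^ 2 ≤ (∫ q, h q) * ∫ q, h q * (q i / energy q) ^ 2 :=
    fun i => integral_mul_sq_le hh h0 (continuous_div_energy i) (abs_div_energy_le_one · i)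
  have h2 : ∑ i : Fin 3, ∫ q, h q * (q i / energy q) ^ 2 =
      (∫ q, h q) - ∫ q, h q * (1 / energy q ^ 2) := by
    rw [← integral_sub hh (integrable_mul_one_div_energy_sq hh), ← integral_finsetSum]
    · congr 1 with q
      rw [← Finset.mul_sum, sum_div_energy_sq]
      ring
    · intro i _
      refine integrable_mul_of_abs_le_one hh ((continuous_div_energy i).pow 2) fun q => ?_
      rw [abs_pow]
      exact pow_le_one₀ (abs_nonneg _) (abs_div_energy_le_one q i)
  have h3 := Finset.sum_le_sum fun i (_ : i ∈ Finset.univ) => h1 i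
  rw [← Finset.mul_sum, h2] at h3
  nlinarith

lemma density_sq (hh : Integrable h) (h0 : 0 ≤ᵐ[volume] h) :
    density h ^ 2 = (∫ q, h q) ^ 2 - ∑ i : Fin 3, flux h i ^ 2 := by
  refine Real.sq_sqrt (le_trans (mul_nonneg (integral_nonneg_of_ae h0)
    (integral_nonneg_of_ae ?_)) (integral_mul_le_sub_flux_sq hh h0))
  filter_upwards [h0] with q hq
  exact mul_nonneg hq (one_div_energy_sq_pos q).le

lemma density_le (h0 : 0 ≤ᵐ[volume] h) : density h ≤ ∫ q, h q := by
  refine Real.sqrt_le_iff.2 ⟨integral_nonneg_of_ae h0, ?_⟩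
  have : 0 ≤ ∑ i : Fin 3, flux h i ^ 2 := Finset.sum_nonneg fun i _ => sq_nonneg _
  linarith

lemma norm_flux_le (hh : Integrable h) (h0 : 0 ≤ᵐ[volume] h) : ‖flux h‖ ≤ ∫ q, h q := by
  refine abs_le_of_sq_le_sq' ?_ (integral_nonneg_of_ae h0) |>.2
  rw [EuclideanSpace.real_norm_sq_eq]
  have := density_sq hh h0
  nlinarith [sq_nonneg (density h)]

lemma integral_one_div_energy_lt_density (hh : Integrable h) (h0 : 0 ≤ᵐ[volume] h)
    (hpos : 0 < ∫ q, h q * (1 / energy q ^ 2)) :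
    ∫ q, h q * (1 / energy q) < density h := by
  refine lt_of_pow_lt_pow_left₀ 2 (Real.sqrt_nonneg _) ?_
  rw [density_sq hh h0]
  exact (integral_one_div_energy_sq_lt hh h0 hpos).trans_le (integral_mul_le_sub_flux_sq hh h0)

lemma energyRatio_mem_Ioo (hh : Integrable h) (h0 : 0 ≤ᵐ[volume] h)
    (hpos : 0 < ∫ q, h q * (1 / energy q ^ 2)) : energyRatio h ∈ Ioo (0 : ℝ) 1 := by
  have h1 := integral_one_div_energy_lt_density hh h0 hpos
  have h2 := hpos.trans_le (integral_one_div_energy_sq_le hh h0)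
  have h3 := h2.trans h1
  unfold energyRatio
  refine ⟨by positivity, ?_⟩
  rwa [one_div, inv_mul_lt_iff₀ h3, mul_one]

lemma beta_pos_of_energyRatio_mem (hr : energyRatio h ∈ Ioo (0 : ℝ) 1) : 0 < beta h :=
  Function.invFunOn_mem (exists_besselRatio_eq hr.1 hr.2)

lemma besselRatio_beta_of_energyRatio_mem (hr : energyRatio h ∈ Ioo (0 : ℝ) 1) :
    besselRatio (beta h) = energyRatio h :=
  Function.invFunOn_eq (exists_besselRatio_eq hr.1 hr.2)

/-- Momentum distributions with uniformly controlled moments. -/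
structure Admissible (a A s : ℝ) (h : Mom → ℝ) : Prop where
  integrable : Integrable h
  nonneg : 0 ≤ᵐ[volume] h
  lower : a ≤ ∫ q, h q * (1 / energy q ^ 2)
  upper : ∫ q, h q ≤ A
  ratio : besselRatio (beta h) ≤ s

namespace Admissible

variable {a A s : ℝ}

lemma pos (H : Admissible a A s h) (ha : 0 < a) : 0 < ∫ q, h q * (1 / energy q ^ 2) :=
  ha.trans_le H.lower

lemma le_density (H : Admissible a A s h) (ha : 0 < a) : a ≤ density h :=
  (H.lower.trans (integral_one_div_energy_sq_le H.integrable H.nonneg)).trans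
    (integral_one_div_energy_lt_density H.integrable H.nonneg (H.pos ha)).le

lemma density_le (H : Admissible a A s h) : density h ≤ A :=
  (MarleBGK.density_le H.nonneg).trans H.upper

lemma bound_pos (H : Admissible a A s h) (ha : 0 < a) : 0 < A :=
  (ha.trans_le (H.le_density ha)).trans_le H.density_le

lemma norm_flux_le (H : Admissible a A s h) : ‖flux h‖ ≤ A :=
  (MarleBGK.norm_flux_le H.integrable H.nonneg).trans H.upper

lemma norm_velocity_le (H : Admissible a A s h) (ha : 0 < a) : ‖velocity h‖ ≤ A / a := by
  have h1 := H.le_density ha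
  have h2 := ha.trans_le h1
  rw [velocity, norm_smul, norm_inv, Real.norm_of_nonneg h2.le, div_eq_inv_mul]
  exact mul_le_mul (inv_anti₀ ha h1) H.norm_flux_le (norm_nonneg _) (inv_nonneg.2 ha.le)

lemma energyRatio_mem (H : Admissible a A s h) (ha : 0 < a) : energyRatio h ∈ Ioo (0 : ℝ) 1 :=
  energyRatio_mem_Ioo H.integrable H.nonneg (H.pos ha)

lemma besselRatio_beta (H : Admissible a A s h) (ha : 0 < a) :
    besselRatio (beta h) = energyRatio h :=
  besselRatio_beta_of_energyRatio_mem (H.energyRatio_mem ha)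

lemma beta_pos (H : Admissible a A s h) (ha : 0 < a) : 0 < beta h :=
  beta_pos_of_energyRatio_mem (H.energyRatio_mem ha)

lemma le_energyRatio (H : Admissible a A s h) (ha : 0 < a) : a / A ≤ energyRatio h := by
  have h1 := H.lower.trans (integral_one_div_energy_sq_le H.integrable H.nonneg)
  have h2 := ha.trans_le (H.le_density ha)
  rw [energyRatio, div_eq_inv_mul, one_div]
  exact mul_le_mul (inv_anti₀ h2 H.density_le) h1 ha.le (inv_nonneg.2 h2.le)

/-- The energy quotient is at least `a / A`, while the Bessel quotient is at most `β / 2`. -/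
lemma le_beta (H : Admissible a A s h) (ha : 0 < a) : 2 * a / A ≤ beta h := by
  have h1 := besselRatio_le_half (H.beta_pos ha)
  have h2 := H.le_energyRatio ha
  rw [← H.besselRatio_beta ha] at h2
  have := h2.trans h1
  rw [mul_div_assoc]
  linarith

/-- Solves `β / (β + 2) ≤ s` for `β`; this is where `s < 1` is indispensable. -/
lemma beta_le (H : Admissible a A s h) (ha : 0 < a) (hs : s < 1) :
    beta h ≤ 2 * s / (1 - s) := by
  have hb := H.beta_pos ha
  have h1 := (div_add_two_le_besselRatio hb).trans H.ratio
  rw [div_le_iff₀ (by linarith)] at h1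
  rw [le_div_iff₀ (by linarith)]
  linarith

end Admissible

/-! ### Lipschitz dependence of the fluid parameters -/

lemma norm_le_sum_abs (v : Mom) : ‖v‖ ≤ ∑ i : Fin 3, |v i| := by
  refine abs_le_of_sq_le_sq' ?_ (Finset.sum_nonneg fun i _ => abs_nonneg _) |>.2
  rw [EuclideanSpace.real_norm_sq_eq]
  simp only [Fin.sum_univ_three]
  nlinarith [sq_abs (v 0), sq_abs (v 1), sq_abs (v 2), abs_nonneg (v 0), abs_nonneg (v 1),
    abs_nonneg (v 2), mul_nonneg (abs_nonneg (v 0)) (abs_nonneg (v 1)),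
    mul_nonneg (abs_nonneg (v 0)) (abs_nonneg (v 2)),
    mul_nonneg (abs_nonneg (v 1)) (abs_nonneg (v 2))]

lemma abs_flux_sub_le (hh : Integrable h) (hk : Integrable k) (i : Fin 3) :
    |flux h i - flux k i| ≤ ∫ q, |h q - k q| :=
  abs_integral_mul_sub_le hh hk (continuous_div_energy i) (abs_div_energy_le_one · i)

lemma norm_flux_sub_le (hh : Integrable h) (hk : Integrable k) :
    ‖flux h - flux k‖ ≤ 3 * ∫ q, |h q - k q| := by
  refine (norm_le_sum_abs _).trans ?_
  have h1 := abs_flux_sub_le hh hk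
  simp only [Fin.sum_univ_three, PiLp.sub_apply]
  linarith [h1 0, h1 1, h1 2]

lemma abs_integral_sub_le (hh : Integrable h) (hk : Integrable k) :
    |(∫ q, h q) - ∫ q, k q| ≤ ∫ q, |h q - k q| := by
  simpa using abs_integral_mul_sub_le hh hk (continuous_const (y := (1 : ℝ))) (by simp)

lemma abs_sq_sub_sq_le {x y A d : ℝ} (hx : |x| ≤ A) (hy : |y| ≤ A) (hd : |x - y| ≤ d) :
    |x ^ 2 - y ^ 2| ≤ 2 * A * d := by
  rw [sq_sub_sq, abs_mul]
  have h1 := abs_add_le x y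
  exact mul_le_mul (by linarith) hd (abs_nonneg _) (by linarith [abs_nonneg x])

section Lipschitz

variable {a A s : ℝ}

/-- The square of the density is a combination of four squared moments, each contributing `2 * A` to
the Lipschitz constant; dividing by `n_h + n_k ≥ 2 * a` removes the square. -/
lemma abs_density_sub_le (ha : 0 < a) (H : Admissible a A s h) (K : Admissible a A s k) :
    |density h - density k| ≤ 4 * A / a * ∫ q, |h q - k q| := by
  have hf : ∀ {l : Mom → ℝ}, Admissible a A s l → ∀ i, |flux l i| ≤ A := fun L i =>
    (PiLp.norm_apply_le _ i).trans L.norm_flux_le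
  have hm : ∀ {l : Mom → ℝ}, Admissible a A s l → |∫ q, l q| ≤ A := fun L => by
    rw [abs_of_nonneg (integral_nonneg_of_ae L.nonneg)]; exact L.upper
  have h1 := abs_sq_sub_sq_le (hm H) (hm K) (abs_integral_sub_le H.integrable K.integrable)
  have h2 : ∀ i, |flux h i ^ 2 - flux k i ^ 2| ≤ _ := fun i =>
    abs_sq_sub_sq_le (hf H i) (hf K i) (abs_flux_sub_le H.integrable K.integrable i)
  have h3 : |density h ^ 2 - density k ^ 2| ≤ 8 * A * ∫ q, |h q - k q| := by
    rw [density_sq H.integrable H.nonneg, density_sq K.integrable K.nonneg]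
    simp only [Fin.sum_univ_three]
    have := h2 0
    have := h2 1
    have := h2 2
    simp only [abs_le] at *
    constructor <;> linarith
  rw [sq_sub_sq, abs_mul] at h3
  have hn := H.le_density ha
  have kn := K.le_density ha
  have h4 : 2 * a ≤ |density h + density k| := by
    rw [abs_of_nonneg (by linarith)]; linarith
  have h5 := (mul_le_mul_of_nonneg_right h4 (abs_nonneg (density h - density k))).trans h3
  rw [div_mul_eq_mul_div, le_div_iff₀ ha]
  linarith

lemma abs_inv_density_sub_le (ha : 0 < a) (H : Admissible a A s h) (K : Admissible a A s k) :
    |(density h)⁻¹ - (density k)⁻¹| ≤ 4 * A / a ^ 3 * ∫ q, |h q - k q| := by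
  have hn := H.le_density ha
  have kn := K.le_density ha
  have h1 := abs_density_sub_le ha K H
  have e : ∫ q, |k q - h q| = ∫ q, |h q - k q| := by simp only [abs_sub_comm]
  rw [e] at h1
  rw [inv_sub_inv (by linarith) (by linarith), abs_div,
    abs_of_pos (mul_pos (ha.trans_le hn) (ha.trans_le kn))]
  have hd : 0 ≤ ∫ q, |h q - k q| := integral_nonneg fun _ => abs_nonneg _
  have hA := H.bound_pos ha
  have := ha.trans_le hn
  calc |density k - density h| / (density h * density k)
      ≤ (4 * A / a * ∫ q, |h q - k q|) / (a * a) := by gcongr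
    _ = _ := by field_simp

lemma norm_velocity_sub_le (ha : 0 < a) (H : Admissible a A s h) (K : Admissible a A s k) :
    ‖velocity h - velocity k‖ ≤ (3 / a + 4 * A ^ 2 / a ^ 3) * ∫ q, |h q - k q| := by
  have e : velocity h - velocity k = (density h)⁻¹ • (flux h - flux k) +
      ((density h)⁻¹ - (density k)⁻¹) • flux k := by
    simp only [velocity, smul_sub, sub_smul]
    abel
  have h1 := norm_flux_sub_le H.integrable K.integrable
  have h2 := abs_inv_density_sub_le ha H K
  have h3 := K.norm_flux_le
  have hn := H.le_density ha
  have h4 : |(density h)⁻¹| ≤ a⁻¹ := by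
    rw [abs_of_pos (inv_pos.2 (ha.trans_le hn))]
    exact inv_anti₀ ha hn
  rw [e]
  refine (norm_add_le _ _).trans ?_
  rw [norm_smul, norm_smul, Real.norm_eq_abs, Real.norm_eq_abs]
  have hd : 0 ≤ ∫ q, |h q - k q| := integral_nonneg fun _ => abs_nonneg _
  have hA := H.bound_pos ha
  calc _ ≤ a⁻¹ * (3 * ∫ q, |h q - k q|) + (4 * A / a ^ 3 * ∫ q, |h q - k q|) * A := by gcongr
    _ = _ := by ring

lemma abs_energyRatio_sub_le (ha : 0 < a) (H : Admissible a A s h) (K : Admissible a A s k) :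
    |energyRatio h - energyRatio k| ≤ (1 / a + 4 * A ^ 2 / a ^ 3) * ∫ q, |h q - k q| := by
  have e : energyRatio h - energyRatio k =
      (density h)⁻¹ * ((∫ q, h q * (1 / energy q)) - ∫ q, k q * (1 / energy q)) +
      ((density h)⁻¹ - (density k)⁻¹) * ∫ q, k q * (1 / energy q) := by
    simp only [energyRatio]
    ring
  have h1 := abs_integral_mul_sub_le H.integrable K.integrable continuous_one_div_energy
    abs_one_div_energy_le_one
  have h2 := abs_inv_density_sub_le ha H K
  have h3 := (abs_integral_mul_le K.integrable K.nonneg abs_one_div_energy_le_one).trans K.upper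
  have hn := H.le_density ha
  have h4 : |(density h)⁻¹| ≤ a⁻¹ := by
    rw [abs_of_pos (inv_pos.2 (ha.trans_le hn))]
    exact inv_anti₀ ha hn
  rw [e]
  refine (abs_add_le _ _).trans ?_
  rw [abs_mul, abs_mul]
  have hd : 0 ≤ ∫ q, |h q - k q| := integral_nonneg fun _ => abs_nonneg _
  have hA := H.bound_pos ha
  calc _ ≤ a⁻¹ * (∫ q, |h q - k q|) + (4 * A / a ^ 3 * ∫ q, |h q - k q|) * A := by gcongr
    _ = _ := by ring

/-- `beta` is the energy quotient followed by the inverse Bessel quotient, and the latter is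
Lipschitz on the compact range of `beta`. -/
lemma exists_abs_beta_sub_le (ha : 0 < a) (hA : 0 < A) (hs : s < 1) :
    ∃ C > 0, ∀ h k : Mom → ℝ, Admissible a A s h → Admissible a A s k →
      |beta h - beta k| ≤ C * ∫ q, |h q - k q| := by
  obtain ⟨c, hc, hR⟩ := exists_mul_abs_le_besselRatio (b₁ := 2 * a / A) (b₂ := 2 * s / (1 - s))
    (by positivity)
  refine ⟨(1 / a + 4 * A ^ 2 / a ^ 3) / c, by positivity, fun h k H K => ?_⟩
  have h1 := hR _ ⟨H.le_beta ha, H.beta_le ha hs⟩ _ ⟨K.le_beta ha, K.beta_le ha hs⟩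
  rw [H.besselRatio_beta ha, K.besselRatio_beta ha] at h1
  rw [div_mul_eq_mul_div, le_div_iff₀ hc, mul_comm]
  exact h1.trans (abs_energyRatio_sub_le ha H K)

end Lipschitz

/-! ### Relativistic Maxwellians -/

/-- The exponential absorbs four more powers of the energy, and `q₀ ^ (-4)` is integrable in
dimension three. -/
lemma integrable_energy_pow_mul_exp (n : ℕ) {c : ℝ} (hc : 0 < c) :
    Integrable fun q : Mom => energy q ^ n * Real.exp (-c * energy q) := by
  have hr : (Module.finrank ℝ Mom : ℝ) < 4 := by simp; norm_num
  have h4 := integrable_rpow_neg_one_add_norm_sq (E := Mom) (μ := volume) hr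
  refine (h4.const_mul ((n + 4).factorial / c ^ (n + 4))).mono'
    (by fun_prop) (Filter.Eventually.of_forall fun q => ?_)
  have hq := energy_pos q
  have h1 := pow_mul_exp_neg_le hc hq.le (n + 4)
  have e : ((1 : ℝ) + ‖q‖ ^ 2) ^ (-(4 : ℝ) / 2) = (energy q ^ 4)⁻¹ := by
    have : (-(4 : ℝ) / 2) = -((2 : ℕ) : ℝ) := by norm_num
    rw [this, Real.rpow_neg (by positivity), Real.rpow_natCast, ← energy_sq, ← pow_mul]
  rw [Real.norm_of_nonneg (by positivity), e, ← div_eq_mul_inv, le_div_iff₀ (by positivity)]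
  refine le_trans (le_of_eq ?_) h1
  rw [pow_add]
  ring

lemma integrable_exp_energy {b : ℝ} (hb : 0 < b) :
    Integrable fun q : Mom => Real.exp (-b * energy q) := by
  simpa using integrable_energy_pow_mul_exp 0 hb

lemma maxwellMass_pos {b : ℝ} (hb : 0 < b) : 0 < maxwellMass b := by
  rw [maxwellMass, integral_pos_iff_support_of_nonneg (fun q => (Real.exp_pos _).le)
    (integrable_exp_energy hb)]
  have : Function.support (fun q : Mom => Real.exp (-b * energy q)) = univ := by
    ext q
    simp
  rw [this]
  exact Measure.measure_univ_pos.2 (NeZero.ne _)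

lemma maxwellMass_anti {b b' : ℝ} (hb : 0 < b) (hbb : b ≤ b') :
    maxwellMass b' ≤ maxwellMass b := by
  refine integral_mono (integrable_exp_energy (hb.trans_le hbb)) (integrable_exp_energy hb)
    fun q => ?_
  have := energy_pos q
  simp only
  gcongr

lemma abs_exp_neg_sub_exp_neg_le {x y z : ℝ} (hx : z ≤ x) (hy : z ≤ y) :
    |Real.exp (-x) - Real.exp (-y)| ≤ |x - y| * Real.exp (-z) := by
  wlog h : x ≤ y generalizing x y
  · rw [abs_sub_comm, abs_sub_comm x]
    exact this hy hx (le_of_not_ge h)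
  have h1 : Real.exp (-y) ≤ Real.exp (-x) := Real.exp_le_exp.2 (by linarith)
  have h2 : Real.exp (-x) ≤ Real.exp (-z) := Real.exp_le_exp.2 (by linarith)
  rw [abs_of_nonneg (by linarith), abs_sub_comm, abs_of_nonneg (by linarith)]
  have h3 : Real.exp (-y) = Real.exp (-x) * Real.exp (-(y - x)) := by
    rw [← Real.exp_add]; congr 1; ring
  have h4 := Real.one_sub_le_exp_neg (y - x)
  have h5 := Real.exp_pos (-x)
  calc Real.exp (-x) - Real.exp (-y) = Real.exp (-x) * (1 - Real.exp (-(y - x))) := by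
        rw [h3]; ring
    _ ≤ Real.exp (-z) * (y - x) :=
        mul_le_mul h2 (by linarith)
          (by linarith [Real.exp_le_one_iff.2 (show -(y - x) ≤ 0 by linarith)])
          (Real.exp_pos _).le
    _ = _ := mul_comm _ _

lemma abs_maxwellMass_sub_le {b₁ b b' : ℝ} (h₁ : 0 < b₁) (hb : b₁ ≤ b) (hb' : b₁ ≤ b') :
    |maxwellMass b - maxwellMass b'| ≤
      |b - b'| * ∫ q : Mom, energy q * Real.exp (-b₁ * energy q) := by
  have hint : Integrable fun q : Mom => energy q * Real.exp (-b₁ * energy q) := by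
    simpa using integrable_energy_pow_mul_exp 1 h₁
  rw [maxwellMass, maxwellMass, ← integral_sub (integrable_exp_energy (h₁.trans_le hb))
    (integrable_exp_energy (h₁.trans_le hb')), ← integral_const_mul]
  refine abs_integral_le_integral_abs.trans (integral_mono_of_nonneg
    (Filter.Eventually.of_forall fun _ => abs_nonneg _) (hint.const_mul _)
    (Filter.Eventually.of_forall fun q => ?_))
  have hq := energy_pos q
  have := abs_exp_neg_sub_exp_neg_le (mul_le_mul_of_nonneg_right hb hq.le)
    (mul_le_mul_of_nonneg_right hb' hq.le)
  simp only [neg_mul]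
  refine this.trans (le_of_eq ?_)
  rw [← sub_mul, abs_mul, abs_of_pos hq]
  ring

lemma measurable_maxwellMass : Measurable maxwellMass := by
  have h : Continuous fun z : ℝ × Mom => Real.exp (-z.1 * energy z.2) := by fun_prop
  exact h.stronglyMeasurable.integral_prod_right'.measurable

/-- The energy of a particle of momentum `q` in the rest frame of the velocity `u`. -/
noncomputable def boostedEnergy (u q : Mom) : ℝ :=
  Real.sqrt (1 + ‖u‖ ^ 2) * energy q - inner ℝ u q

lemma norm_le_sqrt_one_add_sq (u : Mom) : ‖u‖ ≤ Real.sqrt (1 + ‖u‖ ^ 2) :=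
  Real.le_sqrt_of_sq_le (by linarith)

lemma inner_le_mul_energy (u q : Mom) : |inner ℝ u q| ≤ ‖u‖ * energy q :=
  (abs_real_inner_le_norm u q).trans (by gcongr; exact norm_le_energy q)

/-- `√(1 + |u|²) - |u|` is the reciprocal of `√(1 + |u|²) + |u|`, hence bounded below for bounded
`u`. Thus Maxwellians with bounded velocity decay uniformly. -/
lemma le_boostedEnergy {U : ℝ} {u : Mom} (hu : ‖u‖ ≤ U) (q : Mom) :
    (2 * Real.sqrt (1 + U ^ 2))⁻¹ * energy q ≤ boostedEnergy u q := by
  have h1 := norm_le_sqrt_one_add_sq u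
  have h2 := inner_le_mul_energy u q
  have h3 : Real.sqrt (1 + ‖u‖ ^ 2) ≤ Real.sqrt (1 + U ^ 2) := by gcongr
  have h4 : Real.sqrt (1 + ‖u‖ ^ 2) ^ 2 = 1 + ‖u‖ ^ 2 := Real.sq_sqrt (by positivity)
  have h5 : 0 < Real.sqrt (1 + ‖u‖ ^ 2) := by positivity
  have h6 : (2 * Real.sqrt (1 + U ^ 2))⁻¹ ≤ Real.sqrt (1 + ‖u‖ ^ 2) - ‖u‖ := by
    rw [inv_le_iff_one_le_mul₀ (by positivity)]
    nlinarith [norm_nonneg u]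
  have h7 := mul_le_mul_of_nonneg_right h6 (energy_pos q).le
  have := le_abs_self (inner ℝ u q)
  unfold boostedEnergy
  linarith

lemma abs_boostedEnergy_le (u q : Mom) : |boostedEnergy u q| ≤ (1 + 2 * ‖u‖) * energy q := by
  have h1 : Real.sqrt (1 + ‖u‖ ^ 2) ≤ 1 + ‖u‖ :=
    Real.sqrt_le_iff.2 ⟨by positivity, by nlinarith [norm_nonneg u]⟩
  have h2 := inner_le_mul_energy u q
  have h3 := mul_le_mul_of_nonneg_right h1 (energy_pos q).le
  have h4 : 0 ≤ Real.sqrt (1 + ‖u‖ ^ 2) * energy q :=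
    mul_nonneg (Real.sqrt_nonneg _) (energy_pos q).le
  rw [abs_le] at h2
  rw [boostedEnergy, abs_le]
  constructor <;> nlinarith

lemma abs_sqrt_one_add_sq_sub_le (x y : ℝ) :
    |Real.sqrt (1 + x ^ 2) - Real.sqrt (1 + y ^ 2)| ≤ |x - y| := by
  have hx : Real.sqrt (1 + x ^ 2) ^ 2 = 1 + x ^ 2 := Real.sq_sqrt (by positivity)
  have hy : Real.sqrt (1 + y ^ 2) ^ 2 = 1 + y ^ 2 := Real.sq_sqrt (by positivity)
  have h1 : |x| ≤ Real.sqrt (1 + x ^ 2) := Real.abs_le_sqrt (by linarith)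
  have h2 : |y| ≤ Real.sqrt (1 + y ^ 2) := Real.abs_le_sqrt (by linarith)
  have h3 : 0 < Real.sqrt (1 + x ^ 2) + Real.sqrt (1 + y ^ 2) := by positivity
  have h4 := (abs_add_le x y).trans (add_le_add h1 h2)
  have h5 : |Real.sqrt (1 + x ^ 2) - Real.sqrt (1 + y ^ 2)| *
      (Real.sqrt (1 + x ^ 2) + Real.sqrt (1 + y ^ 2)) = |x - y| * |x + y| := by
    rw [← abs_of_pos h3, ← abs_mul, ← abs_mul]
    congr 1
    linear_combination hx - hy
  refine le_of_mul_le_mul_right ?_ h3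
  rw [h5]
  gcongr

lemma abs_boostedEnergy_sub_le (u v q : Mom) :
    |boostedEnergy u q - boostedEnergy v q| ≤ 2 * ‖u - v‖ * energy q := by
  have h1 := (abs_sqrt_one_add_sq_sub_le ‖u‖ ‖v‖).trans (abs_norm_sub_norm_le u v)
  have h2 := inner_le_mul_energy (u - v) q
  have e : boostedEnergy u q - boostedEnergy v q =
      (Real.sqrt (1 + ‖u‖ ^ 2) - Real.sqrt (1 + ‖v‖ ^ 2)) * energy q - inner ℝ (u - v) q := by
    rw [inner_sub_left]
    simp only [boostedEnergy]
    ring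
  rw [e]
  refine (abs_sub _ _).trans ?_
  rw [abs_mul, abs_of_pos (energy_pos q)]
  have := mul_le_mul_of_nonneg_right h1 (energy_pos q).le
  linarith

/-- The Maxwellian with density, velocity and inverse temperature `θ`. -/
noncomputable def maxwellianOf (θ : ℝ × Mom × ℝ) (q : Mom) : ℝ :=
  θ.1 / maxwellMass θ.2.2 * Real.exp (-θ.2.2 * boostedEnergy θ.2.1 q)

/-- Density, velocity and inverse temperature of `h`. -/
noncomputable def fluidParam (h : Mom → ℝ) : ℝ × Mom × ℝ := (density h, velocity h, beta h)

lemma maxwellian_eq (h : Mom → ℝ) : maxwellian h = maxwellianOf (fluidParam h) := rfl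

lemma measurable_maxwellianOf :
    Measurable fun z : (ℝ × Mom × ℝ) × Mom => maxwellianOf z.1 z.2 := by
  have h1 : Continuous fun z : (ℝ × Mom × ℝ) × Mom =>
      Real.exp (-z.1.2.2 * boostedEnergy z.1.2.1 z.2) := by
    unfold boostedEnergy
    fun_prop
  exact (measurable_fst.fst.div (measurable_maxwellMass.comp measurable_fst.snd.snd)).mul
    h1.measurable

/-! ### Uniform and Lipschitz bounds for Maxwellians -/

lemma abs_div_sub_div_le {n n' M M' A m δ ε : ℝ} (hm : 0 < m) (hM : m ≤ M) (hM' : m ≤ M')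
    (hn' : |n'| ≤ A) (hδ : |n - n'| ≤ δ) (hε : |M - M'| ≤ ε) :
    |n / M - n' / M'| ≤ δ / m + A * ε / (m * m) := by
  have p1 := hm.trans_le hM
  have p2 := hm.trans_le hM'
  have e : n / M - n' / M' = (n - n') / M - n' * (M - M') / (M * M') := by
    field_simp
    ring
  rw [e]
  refine (abs_sub _ _).trans ?_
  rw [abs_div, abs_div, abs_mul, abs_of_pos p1, abs_of_pos (mul_pos p1 p2)]
  have h1 := (abs_nonneg _).trans hδ
  have h2 := (abs_nonneg _).trans hε
  have h3 := (abs_nonneg _).trans hn'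
  gcongr

lemma abs_mul_sub_mul_le {x x' y y' A B δ ε : ℝ} (hx : |x| ≤ A) (hy' : |y'| ≤ B)
    (hδ : |x - x'| ≤ δ) (hε : |y - y'| ≤ ε) : |x * y - x' * y'| ≤ A * ε + δ * B := by
  have e : x * y - x' * y' = x * (y - y') + (x - x') * y' := by ring
  rw [e]
  refine (abs_add_le _ _).trans ?_
  rw [abs_mul, abs_mul]
  have h1 := (abs_nonneg _).trans hδ
  have h3 := (abs_nonneg _).trans hx
  gcongr

section Bounds

variable {a A s : ℝ}

lemma exists_maxwellian_coeff_bounds (ha : 0 < a) (hA : 0 < A) (hs : s < 1) :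
    ∃ C > 0, (∀ h, Admissible a A s h → 0 ≤ density h / maxwellMass (beta h) ∧
        density h / maxwellMass (beta h) ≤ C) ∧
      ∀ h k, Admissible a A s h → Admissible a A s k →
        |density h / maxwellMass (beta h) - density k / maxwellMass (beta k)| ≤
          C * ∫ p, |h p - k p| := by
  obtain ⟨Cb, hCb, hβ⟩ := exists_abs_beta_sub_le ha hA hs
  -- Nothing is assumed about the sign of `s`; an admissible member is what shows that `2 * s / (1 -
  -- s)` is positive.
  by_cases hex : ∃ h₀, Admissible a A s h₀
  swap
  · push Not at hex
    exact ⟨1, one_pos, fun h H => (hex h H).elim, fun h _ H => (hex h H).elim⟩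
  obtain ⟨h₀, H₀⟩ := hex
  have hmpos : 0 < maxwellMass (2 * s / (1 - s)) :=
    maxwellMass_pos ((H₀.beta_pos ha).trans_le (H₀.beta_le ha hs))
  have hmass : ∀ {h}, Admissible a A s h → maxwellMass (2 * s / (1 - s)) ≤ maxwellMass (beta h) :=
    fun H => maxwellMass_anti (H.beta_pos ha) (H.beta_le ha hs)
  generalize maxwellMass (2 * s / (1 - s)) = m at hmpos hmass
  have hL : 0 ≤ ∫ q : Mom, energy q * Real.exp (-(2 * a / A) * energy q) :=
    integral_nonneg fun q => mul_nonneg (energy_pos q).le (Real.exp_pos _).le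
  have hM : ∀ h k, Admissible a A s h → Admissible a A s k →
      |maxwellMass (beta h) - maxwellMass (beta k)| ≤ (Cb * ∫ p, |h p - k p|) *
        ∫ q : Mom, energy q * Real.exp (-(2 * a / A) * energy q) := fun h k H K =>
    (abs_maxwellMass_sub_le (by positivity) (H.le_beta ha) (K.le_beta ha)).trans
      (mul_le_mul_of_nonneg_right (hβ h k H K) hL)
  generalize ∫ q : Mom, energy q * Real.exp (-(2 * a / A) * energy q) = L at hL hM
  have hden : ∀ {h}, Admissible a A s h → |density h| ≤ A := fun H => by
    rw [abs_of_pos (ha.trans_le (H.le_density ha))]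
    exact H.density_le
  refine ⟨A / m + ((4 * A / a) / m + A * (Cb * L) / (m * m)), by positivity, fun h H => ?_,
    fun h k H K => ?_⟩
  · have h1 := hmass H
    have h2 := H.density_le
    have h3 := ha.le.trans (H.le_density ha)
    have h4 : density h / maxwellMass (beta h) ≤ A / m := by gcongr
    refine ⟨div_nonneg h3 (hmpos.le.trans h1), h4.trans ?_⟩
    have : 0 ≤ (4 * A / a) / m + A * (Cb * L) / (m * m) := by positivity
    linarith
  · have h1 := abs_div_sub_div_le hmpos (hmass H) (hmass K) (hden K) (abs_density_sub_le ha H K)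
      (hM h k H K)
    have hd : 0 ≤ ∫ p, |h p - k p| := integral_nonneg fun _ => abs_nonneg _
    have h2 : 0 ≤ A / m * ∫ p, |h p - k p| := by positivity
    refine h1.trans (le_of_sub_nonneg (le_of_le_of_eq h2 ?_))
    ring

lemma exists_maxwellian_exponent_bounds (ha : 0 < a) (hA : 0 < A) (hs : s < 1) :
    ∃ c > 0, ∃ C > 0, (∀ h, Admissible a A s h → ∀ q,
        c * energy q ≤ beta h * boostedEnergy (velocity h) q) ∧
      ∀ h k, Admissible a A s h → Admissible a A s k → ∀ q,
        |beta h * boostedEnergy (velocity h) q - beta k * boostedEnergy (velocity k) q| ≤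
          C * energy q * ∫ p, |h p - k p| := by
  obtain ⟨Cb, hCb, hβ⟩ := exists_abs_beta_sub_le ha hA hs
  by_cases hex : ∃ h₀, Admissible a A s h₀
  swap
  · push Not at hex
    exact ⟨1, one_pos, 1, one_pos, fun h H => (hex h H).elim, fun h _ H => (hex h H).elim⟩
  obtain ⟨h₀, H₀⟩ := hex
  have hb₂pos : 0 < 2 * s / (1 - s) := (H₀.beta_pos ha).trans_le (H₀.beta_le ha hs)
  have hb₂ : ∀ {h}, Admissible a A s h → |beta h| ≤ 2 * s / (1 - s) := fun H => by
    rw [abs_of_pos (H.beta_pos ha)]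
    exact H.beta_le ha hs
  generalize 2 * s / (1 - s) = b₂ at hb₂pos hb₂
  refine ⟨2 * a / A * (2 * Real.sqrt (1 + (A / a) ^ 2))⁻¹, by positivity,
    b₂ * (2 * (3 / a + 4 * A ^ 2 / a ^ 3)) + Cb * (1 + 2 * (A / a)), by positivity,
    fun h H q => ?_, fun h k H K q => ?_⟩
  · have h1 := le_boostedEnergy (H.norm_velocity_le ha) q
    have h2 := H.le_beta ha
    have := energy_pos q
    rw [mul_assoc]
    exact mul_le_mul h2 h1 (by positivity) (H.beta_pos ha).le
  · have hq := energy_pos q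
    have h1 : |boostedEnergy (velocity k) q| ≤ (1 + 2 * (A / a)) * energy q :=
      (abs_boostedEnergy_le _ q).trans (by gcongr; exact K.norm_velocity_le ha)
    have h2 : |boostedEnergy (velocity h) q - boostedEnergy (velocity k) q| ≤
        2 * ((3 / a + 4 * A ^ 2 / a ^ 3) * ∫ p, |h p - k p|) * energy q :=
      (abs_boostedEnergy_sub_le _ _ q).trans (by gcongr; exact norm_velocity_sub_le ha H K)
    refine (abs_mul_sub_mul_le (hb₂ H) h1 (hβ h k H K) h2).trans (le_of_eq ?_)
    ring

/-- Maxwellians of admissible distributions are dominated by a fixed integrable function and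
depend on the distribution in a Lipschitz way. -/
lemma exists_maxwellian_bounds (ha : 0 < a) (hA : 0 < A) (hs : s < 1) :
    ∃ c > 0, ∃ C > 0,
      (∀ h, Admissible a A s h → ∀ q, 0 ≤ maxwellian h q ∧
        maxwellian h q ≤ C * (energy q * Real.exp (-c * energy q))) ∧
      ∀ h k, Admissible a A s h → Admissible a A s k → ∀ q,
        |maxwellian h q - maxwellian k q| ≤
          C * (energy q * Real.exp (-c * energy q)) * ∫ p, |h p - k p| := by
  obtain ⟨C₁, hC₁, hcoef, hcoefd⟩ := exists_maxwellian_coeff_bounds ha hA hs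
  obtain ⟨c, hc, C₂, hC₂, hexp, hexpd⟩ := exists_maxwellian_exponent_bounds ha hA hs
  -- Differences of the exponents cost a factor `energy q`; since this is at least one, a single
  -- dominating function serves both bounds.
  have hmul : ∀ q : Mom, Real.exp (-(c * energy q)) ≤ energy q * Real.exp (-c * energy q) :=
    fun q => by
      rw [neg_mul]
      exact le_mul_of_one_le_left (Real.exp_pos _).le (one_le_energy q)
  have e : ∀ h q, maxwellian h q = density h / maxwellMass (beta h) *
      Real.exp (-(beta h * boostedEnergy (velocity h) q)) := fun h q => by
    rw [maxwellian_eq, maxwellianOf, fluidParam, neg_mul]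
  refine ⟨c, hc, C₁ + C₁ * C₂, by positivity, fun h H q => ?_, fun h k H K q => ?_⟩
  · have hq := energy_pos q
    rw [e]
    refine ⟨mul_nonneg (hcoef h H).1 (Real.exp_pos _).le, ?_⟩
    have h1 := (Real.exp_le_exp.2 (neg_le_neg (hexp h H q))).trans (hmul q)
    refine (mul_le_mul (hcoef h H).2 h1 (Real.exp_pos _).le hC₁.le).trans ?_
    gcongr
    nlinarith
  · have hq := energy_pos q
    have h1 := abs_exp_neg_sub_exp_neg_le (hexp h H q) (hexp k K q)
    have h2 : |Real.exp (-(beta h * boostedEnergy (velocity h) q)) -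
        Real.exp (-(beta k * boostedEnergy (velocity k) q))| ≤
        C₂ * energy q * (∫ p, |h p - k p|) * Real.exp (-(c * energy q)) :=
      h1.trans (mul_le_mul_of_nonneg_right (hexpd h k H K q) (Real.exp_pos _).le)
    have h3 : |Real.exp (-(beta k * boostedEnergy (velocity k) q))| ≤
        energy q * Real.exp (-c * energy q) := by
      rw [abs_of_pos (Real.exp_pos _)]
      exact (Real.exp_le_exp.2 (neg_le_neg (hexp k K q))).trans (hmul q)
    have h4 : |density h / maxwellMass (beta h)| ≤ C₁ := by
      rw [abs_of_nonneg (hcoef h H).1]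
      exact (hcoef h H).2
    rw [e, e]
    refine (abs_mul_sub_mul_le h4 h3 (hcoefd h k H K) h2).trans (le_of_eq ?_)
    rw [neg_mul]
    ring

end Bounds

/-! ### The solution operator -/

instance : IsFiniteMeasure slab := by
  unfold slab
  infer_instance

lemma ae_slab_mem : ∀ᵐ x ∂slab, x ∈ Icc (0 : ℝ) 1 := ae_restrict_mem measurableSet_Icc

/-- The damping factor of the inflow data. -/
noncomputable def damp (w x : ℝ) (q : Mom) : ℝ :=
  Real.exp (-(w / |q 0|) * if 0 < q 0 then x else 1 - x)

lemma dampedInflow_eq (fL fR : Mom → ℝ) (w x : ℝ) (q : Mom) :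
    dampedInflow fL fR w x q = damp w x q * inflow fL fR q := by
  unfold dampedInflow damp inflow
  split_ifs <;> simp

lemma damp_le_one {w x : ℝ} (hw : 0 ≤ w) (hx : x ∈ Icc (0 : ℝ) 1) (q : Mom) : damp w x q ≤ 1 := by
  have : 0 ≤ w / |q 0| := by positivity
  refine Real.exp_le_one_iff.2 ?_
  rw [neg_mul, neg_nonpos]
  refine mul_nonneg this ?_
  split_ifs
  · exact hx.1
  · linarith [hx.2]

lemma exp_neg_le_damp {w x : ℝ} (hw : 0 ≤ w) (hx : x ∈ Icc (0 : ℝ) 1) (q : Mom) :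
    Real.exp (-(w / |q 0|)) ≤ damp w x q := by
  have : 0 ≤ w / |q 0| := by positivity
  refine Real.exp_le_exp.2 ?_
  rw [neg_mul, neg_le_neg_iff]
  refine mul_le_of_le_one_right this ?_
  split_ifs
  · exact hx.2
  · linarith [hx.1]

lemma measurable_coord_zero : Measurable fun q : Mom => q 0 := by
  have : Continuous fun q : Mom => q 0 := by fun_prop
  exact this.measurable

lemma measurable_damp (w : ℝ) : Measurable fun z : ℝ × Mom => damp w z.1 z.2 := by
  have h0 : Measurable fun z : ℝ × Mom => z.2 0 := measurable_coord_zero.comp measurable_snd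
  have h1 : Measurable fun z : ℝ × Mom => if 0 < z.2 0 then z.1 else 1 - z.1 :=
    Measurable.ite (measurableSet_lt measurable_const h0) measurable_fst
      (measurable_fst.const_sub 1)
  have h2 : Measurable fun z : ℝ × Mom => |z.2 0| := continuous_abs.measurable.comp h0
  exact Real.measurable_exp.comp ((measurable_const.div h2).neg.mul h1)

/-- The kernel of the integral operator that solves the transport equation. -/
noncomputable def transportKernel (w x y : ℝ) (q : Mom) : ℝ :=
  if (0 < q 0 ∧ y ≤ x) ∨ (q 0 < 0 ∧ x < y) then
    w / |q 0| * Real.exp (-(w / |q 0|) * |x - y|) else 0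

/-- The part of the solution that is generated by the source `J`. -/
noncomputable def gain (w : ℝ) (J : ℝ → Mom → ℝ) (x : ℝ) (q : Mom) : ℝ :=
  ∫ y, transportKernel w x y q * J y q ∂slab

/-- Moving the variable limits into the kernel leaves an integral over a fixed measure, so joint
measurability in `(x, q)` and monotonicity apply directly. -/
lemma gain_eq (w : ℝ) (J : ℝ → Mom → ℝ) {x : ℝ} (hx : x ∈ Icc (0 : ℝ) 1) (q : Mom) :
    gain w J x q =
      if 0 < q 0 then
        w / |q 0| * ∫ y in (0 : ℝ)..x, Real.exp (-(w / |q 0|) * (x - y)) * J y q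
      else if q 0 < 0 then
        w / |q 0| * ∫ y in x..(1 : ℝ), Real.exp (-(w / |q 0|) * (y - x)) * J y q
      else 0 := by
  unfold gain slab
  split_ifs with h1 h2
  · have e : (fun y => transportKernel w x y q * J y q) = (Iic x).indicator
        fun y => w / |q 0| * (Real.exp (-(w / |q 0|) * |x - y|) * J y q) := by
      ext y
      simp only [transportKernel, indicator, mem_Iic, h1, not_lt_of_gt h1, true_and, false_and,
        or_false]
      split_ifs <;> ring
    have e2 : Iic x ∩ Icc (0 : ℝ) 1 = Icc 0 x := by
      ext y
      simp only [mem_inter_iff, mem_Iic, mem_Icc]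
      exact ⟨fun h => ⟨h.2.1, h.1⟩, fun h => ⟨h.2, h.1, h.2.trans hx.2⟩⟩
    rw [e, integral_indicator measurableSet_Iic, Measure.restrict_restrict measurableSet_Iic, e2,
      integral_Icc_eq_integral_Ioc, intervalIntegral.integral_of_le hx.1,
      ← integral_const_mul]
    refine setIntegral_congr_fun measurableSet_Ioc fun y hy => ?_
    simp only
    rw [abs_of_nonneg (sub_nonneg.2 hy.2)]
  · have e : (fun y => transportKernel w x y q * J y q) = (Ioi x).indicator
        fun y => w / |q 0| * (Real.exp (-(w / |q 0|) * |x - y|) * J y q) := by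
      ext y
      simp only [transportKernel, indicator, mem_Ioi, h1, h2, true_and, false_and, false_or]
      split_ifs <;> ring
    have e2 : Ioi x ∩ Icc (0 : ℝ) 1 = Ioc x 1 := by
      ext y
      simp only [mem_inter_iff, mem_Ioi, mem_Icc, mem_Ioc]
      exact ⟨fun h => ⟨h.1, h.2.2⟩, fun h => ⟨h.1, hx.1.trans h.1.le, h.2⟩⟩
    rw [e, integral_indicator measurableSet_Ioi, Measure.restrict_restrict measurableSet_Ioi,
      e2, intervalIntegral.integral_of_le hx.2, ← integral_const_mul]
    refine setIntegral_congr_fun measurableSet_Ioc fun y hy => ?_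
    simp only
    rw [abs_sub_comm, abs_of_nonneg (sub_nonneg.2 hy.1.le)]
  · simp [transportKernel, h1, h2]

lemma solutionOp_eq (fL fR : Mom → ℝ) (w : ℝ) (f : ℝ → Mom → ℝ) {x : ℝ}
    (hx : x ∈ Icc (0 : ℝ) 1) (q : Mom) :
    solutionOp fL fR w f x q =
      dampedInflow fL fR w x q + gain w (fun y => maxwellian (f y)) x q := by
  rw [gain_eq w _ hx]
  unfold solutionOp dampedInflow
  split_ifs <;> simp

lemma transportKernel_nonneg {w : ℝ} (hw : 0 ≤ w) (x y : ℝ) (q : Mom) :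
    0 ≤ transportKernel w x y q := by
  unfold transportKernel
  split_ifs <;> positivity

lemma transportKernel_le {w : ℝ} (hw : 0 ≤ w) (x y : ℝ) (q : Mom) :
    transportKernel w x y q ≤ w / |q 0| := by
  unfold transportKernel
  have h : 0 ≤ w / |q 0| := by positivity
  split_ifs
  · refine mul_le_of_le_one_right h (Real.exp_le_one_iff.2 ?_)
    rw [neg_mul, neg_nonpos]
    positivity
  · exact h

lemma measurable_transportKernel (w : ℝ) :
    Measurable fun z : (ℝ × Mom) × ℝ => transportKernel w z.1.1 z.2 z.1.2 := by
  have h0 : Measurable fun z : (ℝ × Mom) × ℝ => z.1.2 0 :=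
    measurable_coord_zero.comp measurable_fst.snd
  have hx : Measurable fun z : (ℝ × Mom) × ℝ => z.1.1 := measurable_fst.fst
  have hy : Measurable fun z : (ℝ × Mom) × ℝ => z.2 := measurable_snd
  have h2 : Measurable fun z : (ℝ × Mom) × ℝ => w / |z.1.2 0| :=
    measurable_const.div (continuous_abs.measurable.comp h0)
  refine Measurable.ite ?_ (h2.mul (Real.measurable_exp.comp
    (h2.neg.mul (continuous_abs.measurable.comp (hx.sub hy))))) measurable_const
  exact ((measurableSet_lt measurable_const h0).inter (measurableSet_le hy hx)).union
    ((measurableSet_lt h0 measurable_const).inter (measurableSet_lt hx hy))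

lemma integrable_transportKernel {w : ℝ} (hw : 0 ≤ w) (x : ℝ) (q : Mom) :
    Integrable (fun y => transportKernel w x y q) slab := by
  have hm : Measurable fun y => transportKernel w x y q :=
    (measurable_transportKernel w).comp (measurable_prodMk_left (x := (x, q)))
  refine (integrable_const (w / |q 0|)).mono' hm.aestronglyMeasurable
    (Filter.Eventually.of_forall fun y => ?_)
  rw [Real.norm_of_nonneg (transportKernel_nonneg hw x y q)]
  exact transportKernel_le hw x y q

lemma mul_integral_exp_eq (c l : ℝ) :
    c * ∫ y in (0 : ℝ)..l, Real.exp (-c * y) = 1 - Real.exp (-c * l) := by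
  have h : ∀ y ∈ uIcc 0 l, HasDerivAt (fun y => -Real.exp (-c * y)) (c * Real.exp (-c * y)) y :=
    fun y _ => by
      have h1 : HasDerivAt (fun y : ℝ => -c * y) (-c * 1) y := (hasDerivAt_id y).const_mul _
      refine h1.exp.neg.congr_deriv ?_
      ring
  rw [← intervalIntegral.integral_const_mul, intervalIntegral.integral_eq_sub_of_hasDerivAt h
    (Continuous.intervalIntegrable (by fun_prop) _ _)]
  simp
  ring

/-- The fraction of particles of momentum `q` that are scattered within the slab. -/
noncomputable def scatter (w : ℝ) (q : Mom) : ℝ := 1 - Real.exp (-(w / |q 0|))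

lemma integral_transportKernel_le {w : ℝ} (hw : 0 < w) {x : ℝ} (hx : x ∈ Icc (0 : ℝ) 1)
    (q : Mom) : ∫ y, transportKernel w x y q ∂slab ≤ scatter w q := by
  -- The mass of the kernel is the gain of a unit source; it is `1 - exp (-(w / |q 0|) * l)` with `l
  -- = x` or `l = 1 - x`, and `l ≤ 1`.
  have h := gain_eq w (fun _ _ => 1) hx q
  simp only [gain, mul_one] at h
  rw [h, scatter]
  have key : ∀ {l : ℝ}, l ≤ 1 → q 0 ≠ 0 →
      w / |q 0| * ∫ y in (0 : ℝ)..l, Real.exp (-(w / |q 0|) * y) ≤ 1 - Real.exp (-(w / |q 0|)) := by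
    intro l hl hq
    have hc : 0 < w / |q 0| := by positivity
    rw [mul_integral_exp_eq]
    refine sub_le_sub_left (Real.exp_le_exp.2 ?_) _
    nlinarith
  split_ifs with h1 h2
  · rw [intervalIntegral.integral_comp_sub_left (fun y => Real.exp (-(w / |q 0|) * y)) x]
    simp only [sub_self, sub_zero]
    exact key hx.2 h1.ne'
  · rw [intervalIntegral.integral_comp_sub_right (fun y => Real.exp (-(w / |q 0|) * y)) x]
    simp only [sub_self]
    exact key (by linarith [hx.1]) h2.ne
  · have : 0 ≤ w / |q 0| := by positivity
    rw [sub_nonneg, Real.exp_le_one_iff]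
    linarith

lemma scatter_nonneg {w : ℝ} (hw : 0 ≤ w) (q : Mom) : 0 ≤ scatter w q := by
  have : 0 ≤ w / |q 0| := by positivity
  rw [scatter, sub_nonneg, Real.exp_le_one_iff]
  linarith

lemma scatter_le_one (w : ℝ) (q : Mom) : scatter w q ≤ 1 := by
  have := Real.exp_pos (-(w / |q 0|))
  rw [scatter]
  linarith

lemma measurable_scatter (w : ℝ) : Measurable (scatter w) :=
  measurable_const.sub (Real.measurable_exp.comp
    (measurable_const.div (continuous_abs.measurable.comp measurable_coord_zero)).neg)

lemma tendsto_scatter (q : Mom) : Filter.Tendsto (fun w => scatter w q) (nhds 0) (nhds 0) := by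
  have h : Continuous fun w : ℝ => 1 - Real.exp (-(w / |q 0|)) := by fun_prop
  have := h.tendsto 0
  simpa [scatter] using this

/-- Dominated convergence: the scattered fraction is at most one and tends to zero at each `q`. This
is the only source of smallness in the argument. -/
lemma tendsto_integral_scatter_mul {g : Mom → ℝ} (hg : Integrable g) :
    Filter.Tendsto (fun w => ∫ q, scatter w q * g q) (nhdsWithin 0 (Ioi 0)) (nhds 0) := by
  have h := tendsto_integral_filter_of_dominated_convergence (μ := (volume : Measure Mom))
    (l := nhdsWithin (0 : ℝ) (Ioi 0)) (F := fun w q => scatter w q * g q) (f := fun _ => 0)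
    (fun q => ‖g q‖)
    (Filter.Eventually.of_forall fun w => (measurable_scatter w).aestronglyMeasurable.mul hg.1)
    (by
      filter_upwards [self_mem_nhdsWithin] with w hw
      refine Filter.Eventually.of_forall fun q => ?_
      rw [norm_mul, Real.norm_of_nonneg (scatter_nonneg (le_of_lt hw) q)]
      exact mul_le_of_le_one_left (norm_nonneg _) (scatter_le_one w q))
    hg.norm
    (Filter.Eventually.of_forall fun q => by
      have := ((tendsto_scatter q).mul_const (g q)).mono_left
        (nhdsWithin_le_nhds (s := Ioi (0 : ℝ)))
      rwa [zero_mul] at this)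
  simpa using h

lemma integrable_scatter_mul {g : Mom → ℝ} (hg : Integrable g) {w : ℝ} (hw : 0 ≤ w) :
    Integrable fun q => scatter w q * g q :=
  hg.mono ((measurable_scatter w).aestronglyMeasurable.mul hg.1)
    (Filter.Eventually.of_forall fun q => by
      rw [norm_mul, Real.norm_of_nonneg (scatter_nonneg hw q)]
      exact mul_le_of_le_one_left (norm_nonneg _) (scatter_le_one w q))

lemma abs_gain_le {w : ℝ} (hw : 0 < w) {x : ℝ} (hx : x ∈ Icc (0 : ℝ) 1) {q : Mom}
    {J : ℝ → Mom → ℝ} {B : ℝ} (hB : 0 ≤ B) (hJ : ∀ᵐ y ∂slab, |J y q| ≤ B) :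
    |gain w J x q| ≤ scatter w q * B := by
  have h1 : ‖gain w J x q‖ ≤ ∫ y, transportKernel w x y q * B ∂slab := by
    refine norm_integral_le_of_norm_le ((integrable_transportKernel hw.le x q).mul_const B) ?_
    filter_upwards [hJ] with y hy
    rw [norm_mul, Real.norm_of_nonneg (transportKernel_nonneg hw.le x y q)]
    exact mul_le_mul_of_nonneg_left hy (transportKernel_nonneg hw.le x y q)
  refine h1.trans ?_
  rw [integral_mul_const]
  exact mul_le_mul_of_nonneg_right (integral_transportKernel_le hw hx q) hB

lemma gain_nonneg {w : ℝ} (hw : 0 ≤ w) {x : ℝ} {q : Mom} {J : ℝ → Mom → ℝ}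
    (hJ : ∀ᵐ y ∂slab, 0 ≤ J y q) : 0 ≤ gain w J x q := by
  refine integral_nonneg_of_ae ?_
  filter_upwards [hJ] with y hy
  exact mul_nonneg (transportKernel_nonneg hw x y q) hy

lemma integrable_transportKernel_mul {w : ℝ} (hw : 0 ≤ w) (x : ℝ) {q : Mom} {J : ℝ → Mom → ℝ}
    {B : ℝ} (hm : AEStronglyMeasurable (fun y => J y q) slab) (hJ : ∀ᵐ y ∂slab, |J y q| ≤ B) :
    Integrable (fun y => transportKernel w x y q * J y q) slab :=
  (integrable_transportKernel hw x q).mul_bdd hm hJ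

lemma abs_gain_sub_le {w : ℝ} (hw : 0 < w) {x : ℝ} (hx : x ∈ Icc (0 : ℝ) 1) {q : Mom}
    {J J' : ℝ → Mom → ℝ} {B B' D : ℝ} (hD : 0 ≤ D)
    (hm : AEStronglyMeasurable (fun y => J y q) slab) (hJ : ∀ᵐ y ∂slab, |J y q| ≤ B)
    (hm' : AEStronglyMeasurable (fun y => J' y q) slab) (hJ' : ∀ᵐ y ∂slab, |J' y q| ≤ B')
    (hd : ∀ᵐ y ∂slab, |J y q - J' y q| ≤ D) :
    |gain w J x q - gain w J' x q| ≤ scatter w q * D := by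
  have e : gain w J x q - gain w J' x q = gain w (fun y q => J y q - J' y q) x q := by
    rw [gain, gain, ← integral_sub (integrable_transportKernel_mul hw.le x hm hJ)
      (integrable_transportKernel_mul hw.le x hm' hJ'), gain]
    simp only [mul_sub]
  rw [e]
  exact abs_gain_le hw hx hD hd

lemma stronglyMeasurable_gain (w : ℝ) {J : ℝ → Mom → ℝ}
    (hJ : Measurable fun z : ℝ × Mom => J z.1 z.2) :
    StronglyMeasurable fun z : ℝ × Mom => gain w J z.1 z.2 := by
  have h : Measurable fun z : (ℝ × Mom) × ℝ => transportKernel w z.1.1 z.2 z.1.2 * J z.2 z.1.2 :=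
    (measurable_transportKernel w).mul (hJ.comp (measurable_snd.prodMk measurable_fst.snd))
  exact h.stronglyMeasurable.integral_prod_right'

/-! ### Measurability of the fluid parameters -/

/-- The inverse of the ratio of Bessel functions, extended by zero. -/
noncomputable def besselRatioInv (ρ : ℝ) : ℝ :=
  if ρ ∈ Ioo (0 : ℝ) 1 then Function.invFunOn besselRatio (Ioi 0) ρ else 0

/-- Sublevel sets are explicit because `besselRatio` is strictly increasing, so continuity of the
inverse is not needed. -/
lemma measurable_besselRatioInv : Measurable besselRatioInv := by
  have hspec : ∀ {ρ}, ρ ∈ Ioo (0 : ℝ) 1 → 0 < Function.invFunOn besselRatio (Ioi 0) ρ ∧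
      besselRatio (Function.invFunOn besselRatio (Ioi 0) ρ) = ρ := fun hρ =>
    ⟨Function.invFunOn_mem (exists_besselRatio_eq hρ.1 hρ.2),
      Function.invFunOn_eq (exists_besselRatio_eq hρ.1 hρ.2)⟩
  refine measurable_of_Iic fun b => ?_
  rcases lt_trichotomy b 0 with hb | hb | hb
  · have : besselRatioInv ⁻¹' Iic b = ∅ := by
      ext ρ
      simp only [mem_preimage, mem_Iic, mem_empty_iff_false, iff_false, not_le, besselRatioInv]
      split_ifs with h
      · exact hb.trans (hspec h).1
      · exact hb
    rw [this]
    exact MeasurableSet.empty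
  · have : besselRatioInv ⁻¹' Iic b = (Ioo (0 : ℝ) 1)ᶜ := by
      ext ρ
      simp only [mem_preimage, mem_Iic, mem_compl_iff, besselRatioInv]
      split_ifs with h
      · simp only [h, not_true, iff_false, not_le, hb]
        exact (hspec h).1
      · simp [h, hb]
    rw [this]
    exact measurableSet_Ioo.compl
  · have : besselRatioInv ⁻¹' Iic b = (Ioo (0 : ℝ) 1)ᶜ ∪ Iic (besselRatio b) := by
      ext ρ
      simp only [mem_preimage, mem_Iic, mem_compl_iff, besselRatioInv, mem_union]
      split_ifs with h
      · have h2 := hspec h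
        have h3 := strictMonoOn_besselRatio.le_iff_le (mem_Ioi.2 h2.1) (mem_Ioi.2 hb)
        rw [h2.2] at h3
        simp only [h, not_true, false_or]
        exact h3.symm
      · simp [h, hb.le]
    rw [this]
    exact measurableSet_Ioo.compl.union measurableSet_Iic

variable {f : ℝ → Mom → ℝ}

lemma aemeasurable_moment (hf : Integrable (Function.uncurry f) (slab.prod (volume : Measure Mom)))
    {φ : Mom → ℝ} (hφ : Continuous φ) :
    AEMeasurable (fun x => ∫ q, f x q * φ q) slab := by
  have h : AEStronglyMeasurable (fun z : ℝ × Mom => Function.uncurry f z * φ z.2)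
      (slab.prod (volume : Measure Mom)) :=
    hf.1.mul (hφ.comp continuous_snd).aestronglyMeasurable
  exact h.integral_prod_right'.aemeasurable

lemma aemeasurable_density
    (hf : Integrable (Function.uncurry f) (slab.prod (volume : Measure Mom))) :
    AEMeasurable (fun x => density (f x)) slab := by
  have h0 : AEMeasurable (fun x => ∫ q, f x q) slab := by
    simpa using aemeasurable_moment hf (continuous_const (y := (1 : ℝ)))
  have h1 : ∀ i : Fin 3, AEMeasurable (fun x => flux (f x) i) slab := fun i =>
    aemeasurable_moment hf (continuous_div_energy i)
  simp only [density, Fin.sum_univ_three]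
  exact Real.continuous_sqrt.measurable.comp_aemeasurable ((h0.pow_const 2).sub
    ((((h1 0).pow_const 2).add ((h1 1).pow_const 2)).add ((h1 2).pow_const 2)))

lemma aemeasurable_flux
    (hf : Integrable (Function.uncurry f) (slab.prod (volume : Measure Mom))) :
    AEMeasurable (fun x => flux (f x)) slab := by
  have h1 : AEMeasurable (fun x i => ∫ q : Mom, f x q * (q i / energy q)) slab :=
    aemeasurable_pi_lambda _ fun i => aemeasurable_moment hf (continuous_div_energy i)
  exact (WithLp.measurable_toLp 2 (Fin 3 → ℝ)).comp_aemeasurable h1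

lemma aemeasurable_fluidParam
    (hf : Integrable (Function.uncurry f) (slab.prod (volume : Measure Mom)))
    (hr : ∀ᵐ x ∂slab, energyRatio (f x) ∈ Ioo (0 : ℝ) 1) :
    AEMeasurable (fun x => fluidParam (f x)) slab := by
  have hd := aemeasurable_density hf
  have hv : AEMeasurable (fun x => velocity (f x)) slab := hd.inv.smul (aemeasurable_flux hf)
  have he : AEMeasurable (fun x => energyRatio (f x)) slab :=
    (aemeasurable_const.div hd).mul (aemeasurable_moment hf continuous_one_div_energy)
  -- Outside `(0, 1)` the value of `beta` is an arbitrary choice, so it is first replaced by the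
  -- extension by zero, which agrees almost everywhere.
  have hb : AEMeasurable (fun x => beta (f x)) slab := by
    refine (measurable_besselRatioInv.comp_aemeasurable he).congr ?_
    filter_upwards [hr] with x hx
    simp only [Function.comp, besselRatioInv, if_pos hx, beta]
  exact hd.prodMk (hv.prodMk hb)

/-! ### The inflow data -/

section Inflow

variable {fL fR : Mom → ℝ}

lemma integrable_dampedInflow (hint : Integrable (inflow fL fR)) {w x : ℝ} (hw : 0 ≤ w)
    (hx : x ∈ Icc (0 : ℝ) 1) : Integrable (dampedInflow fL fR w x) := by
  have hm : Measurable (damp w x) := (measurable_damp w).comp measurable_prodMk_left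
  refine hint.mono ((hm.aestronglyMeasurable.mul hint.1).congr
    (Filter.Eventually.of_forall fun q => (dampedInflow_eq fL fR w x q).symm))
    (Filter.Eventually.of_forall fun q => ?_)
  rw [dampedInflow_eq, norm_mul, Real.norm_of_nonneg (r := damp w x q) (Real.exp_pos _).le]
  exact mul_le_of_le_one_left (norm_nonneg _) (damp_le_one hw hx q)

lemma dampedInflow_nonneg (hnonneg : 0 ≤ᵐ[volume] inflow fL fR) (w x : ℝ) :
    0 ≤ᵐ[volume] dampedInflow fL fR w x := by
  filter_upwards [hnonneg] with q hq
  rw [dampedInflow_eq]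
  exact mul_nonneg (Real.exp_pos _).le hq

lemma dampedInflow_le (hnonneg : 0 ≤ᵐ[volume] inflow fL fR) {w x : ℝ} (hw : 0 ≤ w)
    (hx : x ∈ Icc (0 : ℝ) 1) : ∀ᵐ q, dampedInflow fL fR w x q ≤ inflow fL fR q := by
  filter_upwards [hnonneg] with q hq
  rw [dampedInflow_eq]
  exact mul_le_of_le_one_left hq (damp_le_one hw hx q)

/-- The inflow data with maximal damping. -/
noncomputable def fullyDamped (fL fR : Mom → ℝ) (w : ℝ) (q : Mom) : ℝ :=
  Real.exp (-(w / |q 0|)) * inflow fL fR q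

lemma integrable_fullyDamped (hint : Integrable (inflow fL fR)) {w : ℝ} (hw : 0 ≤ w) :
    Integrable (fullyDamped fL fR w) := by
  have h := hint.sub (integrable_scatter_mul hint hw)
  refine h.congr (Filter.Eventually.of_forall fun q => ?_)
  simp only [Pi.sub_apply, scatter, fullyDamped]
  ring

lemma fullyDamped_le_dampedInflow (hnonneg : 0 ≤ᵐ[volume] inflow fL fR) {w x : ℝ} (hw : 0 ≤ w)
    (hx : x ∈ Icc (0 : ℝ) 1) : ∀ᵐ q, fullyDamped fL fR w q ≤ dampedInflow fL fR w x q := by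
  filter_upwards [hnonneg] with q hq
  rw [dampedInflow_eq]
  exact mul_le_mul_of_nonneg_right (exp_neg_le_damp hw hx q) hq

lemma fullyDamped_nonneg (hnonneg : 0 ≤ᵐ[volume] inflow fL fR) (w : ℝ) :
    0 ≤ᵐ[volume] fullyDamped fL fR w := by
  filter_upwards [hnonneg] with q hq
  exact mul_nonneg (Real.exp_pos _).le hq

/-! ### Bounds for `a_l` and `λ`, uniform in `x` and small `w` -/

lemma aLower_eq (fL fR : Mom → ℝ) (w : ℝ) :
    aLower fL fR w = ∫ q, fullyDamped fL fR w q * (1 / energy q ^ 2) := rfl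

lemma integral_mul_mono {h k φ : Mom → ℝ} (hh : Integrable fun q => h q * φ q)
    (hk : Integrable fun q => k q * φ q) (hhk : ∀ᵐ q, h q ≤ k q) (hφ : ∀ q, 0 ≤ φ q) :
    ∫ q, h q * φ q ≤ ∫ q, k q * φ q := by
  refine integral_mono_ae hh hk ?_
  filter_upwards [hhk] with q hq
  exact mul_le_mul_of_nonneg_right hq (hφ q)

lemma aLower_anti (hnonneg : 0 ≤ᵐ[volume] inflow fL fR) (hint : Integrable (inflow fL fR))
    {w w' : ℝ} (hw : 0 ≤ w) (hww : w ≤ w') : aLower fL fR w' ≤ aLower fL fR w := by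
  rw [aLower_eq, aLower_eq]
  refine integral_mul_mono
    (integrable_mul_one_div_energy_sq (integrable_fullyDamped hint (hw.trans hww)))
    (integrable_mul_one_div_energy_sq (integrable_fullyDamped hint hw)) ?_
    fun q => (one_div_energy_sq_pos q).le
  filter_upwards [hnonneg] with q hq
  unfold fullyDamped
  gcongr

lemma aLower_le_dampedInflow (hnonneg : 0 ≤ᵐ[volume] inflow fL fR)
    (hint : Integrable (inflow fL fR)) {w x : ℝ} (hw : 0 ≤ w) (hx : x ∈ Icc (0 : ℝ) 1) :
    aLower fL fR w ≤ ∫ q, dampedInflow fL fR w x q * (1 / energy q ^ 2) := by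
  rw [aLower_eq]
  exact integral_mul_mono (integrable_mul_one_div_energy_sq (integrable_fullyDamped hint hw))
    (integrable_mul_one_div_energy_sq (integrable_dampedInflow hint hw hx))
    (fullyDamped_le_dampedInflow hnonneg hw hx) fun q => (one_div_energy_sq_pos q).le

lemma tendsto_integral_fullyDamped_mul {φ : Mom → ℝ}
    (hi : Integrable fun q => inflow fL fR q * φ q) :
    Filter.Tendsto (fun w => ∫ q, fullyDamped fL fR w q * φ q) (nhdsWithin 0 (Ioi 0))
      (nhds (∫ q, inflow fL fR q * φ q)) := by
  have h := (tendsto_integral_scatter_mul hi).const_sub (∫ q, inflow fL fR q * φ q)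
  rw [sub_zero] at h
  refine h.congr' ?_
  filter_upwards [self_mem_nhdsWithin] with w hw
  rw [← integral_sub hi (integrable_scatter_mul hi (le_of_lt hw))]
  congr 1 with q
  simp only [scatter, fullyDamped]
  ring

/-- The numerator is compared with the undamped inflow and the denominator with the maximally damped
one. The bound loses its dependence on `x` but keeps the right limit as `w → 0`. -/
lemma lam_le {w x : ℝ} (hnonneg : 0 ≤ᵐ[volume] inflow fL fR)
    (hint : Integrable (inflow fL fR)) (hw : 0 ≤ w) (ha : 0 < aLower fL fR w)
    (hx : x ∈ Icc (0 : ℝ) 1) :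
    lam fL fR w x ≤ (∫ q, inflow fL fR q * (1 / energy q)) *
      (Real.sqrt ((∫ q, fullyDamped fL fR w q) *
        ∫ q, fullyDamped fL fR w q * (1 / energy q ^ 2)))⁻¹ := by
  have i1 := integrable_dampedInflow hint hw hx
  have i2 := integrable_fullyDamped hint hw
  have n1 := dampedInflow_nonneg hnonneg w x
  have n2 := fullyDamped_nonneg hnonneg w
  have p2 : 0 < ∫ q, fullyDamped fL fR w q * (1 / energy q ^ 2) := ha
  have p1 : 0 < ∫ q, fullyDamped fL fR w q := p2.trans_le
    ((integral_one_div_energy_sq_le i2 n2).trans (integral_one_div_energy_le i2 n2))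
  have h1 : ∫ q, fullyDamped fL fR w q ≤ ∫ q, dampedInflow fL fR w x q :=
    integral_mono_ae i2 i1 (fullyDamped_le_dampedInflow hnonneg hw hx)
  have h2 := aLower_le_dampedInflow hnonneg hint hw hx
  rw [aLower_eq] at h2
  have h3 : ∫ q, dampedInflow fL fR w x q * (1 / energy q) ≤
      ∫ q, inflow fL fR q * (1 / energy q) :=
    integral_mul_mono (integrable_mul_one_div_energy i1) (integrable_mul_one_div_energy hint)
      (dampedInflow_le hnonneg hw hx) fun q => (one_div_energy_pos q).le
  have h0 : 0 ≤ ∫ q, dampedInflow fL fR w x q * (1 / energy q) :=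
    (p2.le.trans h2).trans (integral_one_div_energy_sq_le i1 n1)
  unfold lam
  refine mul_le_mul h3 ?_ (by positivity) (h0.trans h3)
  refine inv_anti₀ (Real.sqrt_pos.2 (mul_pos p1 p2)) (Real.sqrt_le_sqrt ?_)
  exact mul_le_mul h1 h2 p2.le (p1.le.trans h1)

/-- The quotient `λ` is bounded away from one for small collision frequencies. -/
lemma exists_lam_le (hnonneg : 0 ≤ᵐ[volume] inflow fL fR) (hint : Integrable (inflow fL fR))
    (hal : ∀ w, 0 < w → 0 < aLower fL fR w) :
    ∃ l, 0 < l ∧ l < 1 ∧ ∀ᶠ w in nhdsWithin (0 : ℝ) (Ioi 0), ∀ x ∈ Icc (0 : ℝ) 1,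
      lam fL fR w x ≤ l := by
  have hmono : aLower fL fR 1 ≤ ∫ q, inflow fL fR q * (1 / energy q ^ 2) := by
    rw [aLower_eq]
    refine integral_mul_mono
      (integrable_mul_one_div_energy_sq (integrable_fullyDamped hint zero_le_one))
      (integrable_mul_one_div_energy_sq hint) ?_ fun q => (one_div_energy_sq_pos q).le
    filter_upwards [hnonneg] with q hq
    refine mul_le_of_le_one_left hq (Real.exp_le_one_iff.2 ?_)
    rw [neg_nonpos]
    positivity
  have hpos := (hal 1 one_pos).trans_le hmono
  have hlt := integral_one_div_energy_sq_lt hint hnonneg hpos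
  have h1 := integral_one_div_energy_sq_le hint hnonneg
  have h2 := integral_one_div_energy_le hint hnonneg
  have hN := hpos.trans_le h1
  have hlim : Filter.Tendsto (fun w => (∫ q, inflow fL fR q * (1 / energy q)) *
      (Real.sqrt ((∫ q, fullyDamped fL fR w q) *
        ∫ q, fullyDamped fL fR w q * (1 / energy q ^ 2)))⁻¹) (nhdsWithin 0 (Ioi 0))
      (nhds ((∫ q, inflow fL fR q * (1 / energy q)) *
      (Real.sqrt ((∫ q, inflow fL fR q) *
        ∫ q, inflow fL fR q * (1 / energy q ^ 2)))⁻¹)) := by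
    have t1 : Filter.Tendsto (fun w => ∫ q, fullyDamped fL fR w q) (nhdsWithin 0 (Ioi 0))
        (nhds (∫ q, inflow fL fR q)) := by
      simpa using tendsto_integral_fullyDamped_mul (fL := fL) (fR := fR) (φ := fun _ => 1)
        (by simpa using hint)
    have t2 := tendsto_integral_fullyDamped_mul (integrable_mul_one_div_energy_sq hint)
    refine (((t1.mul t2).sqrt).inv₀ ?_).const_mul _
    exact (Real.sqrt_pos.2 (mul_pos (hN.trans_le h2) hpos)).ne'
  have hl : (∫ q, inflow fL fR q * (1 / energy q)) *
      (Real.sqrt ((∫ q, inflow fL fR q) *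
        ∫ q, inflow fL fR q * (1 / energy q ^ 2)))⁻¹ < 1 := by
    have hP := Real.sqrt_pos.2 (mul_pos (hN.trans_le h2) hpos)
    rw [mul_inv_lt_iff₀ hP, one_mul]
    exact Real.lt_sqrt_of_sq_lt hlt
  -- Any `l` strictly between the limit and one works; the maximum with zero makes `l` positive as
  -- well.
  obtain ⟨l, hl1, hl2⟩ := exists_between (max_lt hl one_pos)
  refine ⟨l, (le_max_right _ _).trans_lt hl1, hl2, ?_⟩
  filter_upwards [hlim.eventually_lt_const ((le_max_left _ _).trans_lt hl1), self_mem_nhdsWithin]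
    with w hw hw0 x hx
  exact (lam_le hnonneg hint (le_of_lt hw0) (hal w hw0) hx).trans hw.le

lemma le_sqrt_integral_mul {h : Mom → ℝ} (hh : Integrable h) (h0 : 0 ≤ᵐ[volume] h) {a : ℝ}
    (ha : 0 < a) (hpos : a ≤ ∫ q, h q * (1 / energy q ^ 2)) :
    a ≤ Real.sqrt ((∫ q, h q) * ∫ q, h q * (1 / energy q ^ 2)) := by
  have h1 := (integral_one_div_energy_sq_le hh h0).trans (integral_one_div_energy_le hh h0)
  refine Real.le_sqrt_of_sq_le ?_
  rw [sq]
  exact mul_le_mul (hpos.trans h1) hpos ha.le (ha.le.trans (hpos.trans h1))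

/-- Needed because the gap `√λ - λ` also closes as `λ → 0`. -/
lemma le_lam (hnonneg : 0 ≤ᵐ[volume] inflow fL fR) (hint : Integrable (inflow fL fR))
    {w x a : ℝ} (hw : 0 ≤ w) (ha : 0 < a) (haw : a ≤ aLower fL fR w) (hx : x ∈ Icc (0 : ℝ) 1) :
    a / ∫ q, inflow fL fR q ≤ lam fL fR w x := by
  have i1 := integrable_dampedInflow hint hw hx
  have n1 := dampedInflow_nonneg hnonneg w x
  have h2 := haw.trans (aLower_le_dampedInflow hnonneg hint hw hx)
  have h3 := integral_one_div_energy_sq_le i1 n1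
  have h4 := integral_one_div_energy_le i1 n1
  have h5 := integral_mono_ae i1 hint (dampedInflow_le hnonneg hw hx)
  have h6 := le_sqrt_integral_mul i1 n1 ha h2
  have h7 : Real.sqrt ((∫ q, dampedInflow fL fR w x q) *
      ∫ q, dampedInflow fL fR w x q * (1 / energy q ^ 2)) ≤ ∫ q, inflow fL fR q := by
    have h8 : 0 ≤ ∫ q, dampedInflow fL fR w x q := by linarith
    refine le_trans (Real.sqrt_le_iff.2 ⟨h8, ?_⟩) h5
    rw [sq]
    exact mul_le_mul_of_nonneg_left (h3.trans h4) h8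
  rw [lam, div_eq_mul_inv]
  exact mul_le_mul (h2.trans h3) (inv_anti₀ (ha.trans_le h6) h7)
    (inv_nonneg.2 ((ha.le.trans h6).trans h7)) (ha.le.trans (h2.trans h3))

lemma energyRatio_le {h : Mom → ℝ} (hh : Integrable h) (h0 : 0 ≤ᵐ[volume] h)
    (hpos : 0 < ∫ q, h q * (1 / energy q ^ 2)) :
    energyRatio h ≤ (∫ q, h q * (1 / energy q)) *
      (Real.sqrt ((∫ q, h q) * ∫ q, h q * (1 / energy q ^ 2)))⁻¹ := by
  have h1 := le_sqrt_integral_mul hh h0 hpos le_rfl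
  have h2 : Real.sqrt ((∫ q, h q) * ∫ q, h q * (1 / energy q ^ 2)) ≤ density h :=
    Real.sqrt_le_sqrt (integral_mul_le_sub_flux_sq hh h0)
  rw [energyRatio, one_div, mul_comm]
  exact mul_le_mul_of_nonneg_left (inv_anti₀ (hpos.trans_le h1) h2)
    (hpos.le.trans (integral_one_div_energy_sq_le hh h0))

/-- Adding a perturbation of small mass to the damped inflow data changes the energy ratio by a
small amount. -/
lemma energyRatio_le_lam_add (hnonneg : 0 ≤ᵐ[volume] inflow fL fR)
    (hint : Integrable (inflow fL fR)) {w x a : ℝ} (hw : 0 ≤ w) (ha : 0 < a)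
    (haw : a ≤ aLower fL fR w) (hx : x ∈ Icc (0 : ℝ) 1) {T : Mom → ℝ} (hT : Integrable T)
    (hT0 : ∀ q, 0 ≤ T q) :
    energyRatio (fun q => dampedInflow fL fR w x q + T q) ≤ lam fL fR w x + (∫ q, T q) / a := by
  have i1 := integrable_dampedInflow hint hw hx
  have n1 := dampedInflow_nonneg hnonneg w x
  have h2 := haw.trans (aLower_le_dampedInflow hnonneg hint hw hx)
  have h6 := le_sqrt_integral_mul i1 n1 ha h2
  have iΦ : Integrable fun q => dampedInflow fL fR w x q + T q := i1.add hT
  have nΦ : 0 ≤ᵐ[volume] fun q => dampedInflow fL fR w x q + T q := by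
    filter_upwards [n1] with q hq
    exact add_nonneg hq (hT0 q)
  have hle : ∀ᵐ q, dampedInflow fL fR w x q ≤ dampedInflow fL fR w x q + T q :=
    Filter.Eventually.of_forall fun q => le_add_of_nonneg_right (hT0 q)
  have g2 := integral_mul_mono (integrable_mul_one_div_energy_sq i1)
    (integrable_mul_one_div_energy_sq iΦ) hle fun q => (one_div_energy_sq_pos q).le
  have g1 := integral_mono_ae i1 iΦ hle
  have g0 : 0 ≤ ∫ q, dampedInflow fL fR w x q := integral_nonneg_of_ae n1
  have hT1 : ∫ q, T q * (1 / energy q) ≤ ∫ q, T q :=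
    integral_one_div_energy_le hT (Filter.Eventually.of_forall hT0)
  have hTn : 0 ≤ ∫ q, T q := integral_nonneg hT0
  have hsum : ∫ q, (dampedInflow fL fR w x q + T q) * (1 / energy q) =
      (∫ q, dampedInflow fL fR w x q * (1 / energy q)) + ∫ q, T q * (1 / energy q) := by
    rw [← integral_add (integrable_mul_one_div_energy i1) (integrable_mul_one_div_energy hT)]
    simp only [add_mul]
  have g3 : 0 ≤ ∫ q, dampedInflow fL fR w x q * (1 / energy q) :=
    (ha.le.trans h2).trans (integral_one_div_energy_sq_le i1 n1)
  refine (energyRatio_le iΦ nΦ ((ha.trans_le h2).trans_le g2)).trans ?_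
  have hs : Real.sqrt ((∫ q, dampedInflow fL fR w x q) *
      ∫ q, dampedInflow fL fR w x q * (1 / energy q ^ 2)) ≤
      Real.sqrt ((∫ q, (dampedInflow fL fR w x q + T q)) *
      ∫ q, (dampedInflow fL fR w x q + T q) * (1 / energy q ^ 2)) :=
    Real.sqrt_le_sqrt (mul_le_mul g1 g2 (ha.le.trans h2) (g0.trans g1))
  rw [hsum, lam]
  calc _ ≤ ((∫ q, dampedInflow fL fR w x q * (1 / energy q)) + ∫ q, T q) *
        (Real.sqrt ((∫ q, dampedInflow fL fR w x q) *
          ∫ q, dampedInflow fL fR w x q * (1 / energy q ^ 2)))⁻¹ := by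
        refine mul_le_mul (by linarith) (inv_anti₀ (ha.trans_le h6) hs) (by positivity)
          (by linarith)
    _ ≤ _ := by
        rw [add_mul, div_eq_mul_inv]
        gcongr

end Inflow

/-! ### Self-mapping and contraction -/

section Source

variable {f g : ℝ → Mom → ℝ} {a A s w : ℝ} {G : Mom → ℝ}

/-- The fluid parameters are modified on a null set of positions, rather than the Maxwellian itself,
so the exceptional set does not depend on `q`. -/
lemma exists_measurable_maxwellian
    (hf : Integrable (Function.uncurry f) (slab.prod (volume : Measure Mom)))
    (hr : ∀ᵐ x ∂slab, energyRatio (f x) ∈ Ioo (0 : ℝ) 1) :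
    ∃ J : ℝ → Mom → ℝ, (Measurable fun z : ℝ × Mom => J z.1 z.2) ∧
      ∀ᵐ y ∂slab, ∀ q, maxwellian (f y) q = J y q := by
  have h := aemeasurable_fluidParam hf hr
  refine ⟨fun y => maxwellianOf (h.mk _ y), measurable_maxwellianOf.comp
    ((h.measurable_mk.comp measurable_fst).prodMk measurable_snd), ?_⟩
  filter_upwards [h.ae_eq_mk] with y hy q
  rw [maxwellian_eq, hy]

lemma gain_congr {J J' : ℝ → Mom → ℝ} (h : ∀ᵐ y ∂slab, ∀ q, J y q = J' y q) :
    gain w J = gain w J' := by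
  ext x q
  refine integral_congr_ae ?_
  filter_upwards [h] with y hy
  rw [hy]

lemma stronglyMeasurable_gain_maxwellian
    (hf : Integrable (Function.uncurry f) (slab.prod (volume : Measure Mom)))
    (hr : ∀ᵐ x ∂slab, energyRatio (f x) ∈ Ioo (0 : ℝ) 1) :
    StronglyMeasurable fun z : ℝ × Mom => gain w (fun y => maxwellian (f y)) z.1 z.2 := by
  obtain ⟨J, hJ, hJf⟩ := exists_measurable_maxwellian hf hr
  rw [gain_congr hJf]
  exact stronglyMeasurable_gain w hJ

lemma aestronglyMeasurable_maxwellian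
    (hf : Integrable (Function.uncurry f) (slab.prod (volume : Measure Mom)))
    (hr : ∀ᵐ x ∂slab, energyRatio (f x) ∈ Ioo (0 : ℝ) 1) (q : Mom) :
    AEStronglyMeasurable (fun y => maxwellian (f y) q) slab := by
  obtain ⟨J, hJ, hJf⟩ := exists_measurable_maxwellian hf hr
  have hm : Measurable fun y => J y q := hJ.comp (measurable_id.prodMk measurable_const)
  refine ⟨_, hm.stronglyMeasurable, ?_⟩
  filter_upwards [hJf] with y hy
  exact hy q

variable {fL fR : Mom → ℝ}

lemma ae_admissible_of_mem_solutionSpace {l : ℝ} (haw : a ≤ aLower fL fR w)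
    (hl : ∀ x ∈ Icc (0 : ℝ) 1, lam fL fR w x ≤ l) (hf : f ∈ solutionSpace fL fR w) :
    ∀ᵐ x ∂slab, Admissible a (aUpper fL fR) (Real.sqrt l) (f x) := by
  filter_upwards [hf.1.prod_right_ae, hf.2, ae_slab_mem] with x hx h hmem
  exact ⟨hx, h.1, haw.trans h.2.1, h.2.2.1, h.2.2.2.trans (Real.sqrt_le_sqrt (hl x hmem))⟩

lemma gain_maxwellian_nonneg (hw : 0 ≤ w)
    (hJ : ∀ᵐ y ∂slab, ∀ q, 0 ≤ maxwellian (f y) q ∧ maxwellian (f y) q ≤ G q) (x : ℝ) (q : Mom) :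
    0 ≤ gain w (fun y => maxwellian (f y)) x q :=
  gain_nonneg hw (hJ.mono fun _ hy => (hy q).1)

lemma gain_maxwellian_le (hw : 0 < w) (hG : ∀ q, 0 ≤ G q)
    (hJ : ∀ᵐ y ∂slab, ∀ q, 0 ≤ maxwellian (f y) q ∧ maxwellian (f y) q ≤ G q)
    {x : ℝ} (hx : x ∈ Icc (0 : ℝ) 1) (q : Mom) :
    gain w (fun y => maxwellian (f y)) x q ≤ scatter w q * G q :=
  (le_abs_self _).trans (abs_gain_le hw hx (hG q) (hJ.mono fun _ hy => by
    rw [abs_of_nonneg (hy q).1]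
    exact (hy q).2))

lemma integrable_gain_maxwellian (hw : 0 < w) (hG : ∀ q, 0 ≤ G q) (hGi : Integrable G)
    (hf : Integrable (Function.uncurry f) (slab.prod (volume : Measure Mom)))
    (hr : ∀ᵐ x ∂slab, energyRatio (f x) ∈ Ioo (0 : ℝ) 1)
    (hJ : ∀ᵐ y ∂slab, ∀ q, 0 ≤ maxwellian (f y) q ∧ maxwellian (f y) q ≤ G q)
    {x : ℝ} (hx : x ∈ Icc (0 : ℝ) 1) :
    Integrable (gain w (fun y => maxwellian (f y)) x) ∧
      ∫ q, gain w (fun y => maxwellian (f y)) x q ≤ ∫ q, scatter w q * G q := by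
  have hi : Integrable (gain w (fun y => maxwellian (f y)) x) := by
    refine (integrable_scatter_mul hGi hw.le).mono'
      ((stronglyMeasurable_gain_maxwellian hf hr).comp_measurable
        measurable_prodMk_left).aestronglyMeasurable (Filter.Eventually.of_forall fun q => ?_)
    rw [Real.norm_of_nonneg (gain_maxwellian_nonneg hw.le hJ x q)]
    exact gain_maxwellian_le hw hG hJ hx q
  exact ⟨hi, integral_mono hi (integrable_scatter_mul hGi hw.le) (gain_maxwellian_le hw hG hJ hx)⟩

lemma integrable_solutionOp (hint : Integrable (inflow fL fR)) (hw : 0 < w) (hG : ∀ q, 0 ≤ G q)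
    (hGi : Integrable G)
    (hf : Integrable (Function.uncurry f) (slab.prod (volume : Measure Mom)))
    (hr : ∀ᵐ x ∂slab, energyRatio (f x) ∈ Ioo (0 : ℝ) 1)
    (hJ : ∀ᵐ y ∂slab, ∀ q, 0 ≤ maxwellian (f y) q ∧ maxwellian (f y) q ≤ G q) :
    Integrable (Function.uncurry (solutionOp fL fR w f)) (slab.prod (volume : Measure Mom)) := by
  have hmem : ∀ᵐ z ∂(slab.prod (volume : Measure Mom)), z.1 ∈ Icc (0 : ℝ) 1 :=
    Measure.quasiMeasurePreserving_fst.ae ae_slab_mem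
  have hbound : Integrable (fun z : ℝ × Mom => ‖inflow fL fR z.2‖ + G z.2)
      (slab.prod (volume : Measure Mom)) := (hint.norm.add hGi).comp_snd slab
  refine hbound.mono' ?_ ?_
  · have h1 : AEStronglyMeasurable (fun z : ℝ × Mom => damp w z.1 z.2 * inflow fL fR z.2)
        (slab.prod (volume : Measure Mom)) :=
      (measurable_damp w).aestronglyMeasurable.mul hint.1.comp_snd
    refine (h1.add (stronglyMeasurable_gain_maxwellian
      (w := w) hf hr).aestronglyMeasurable).congr ?_
    filter_upwards [hmem] with z hz
    simp only [Function.uncurry, Pi.add_apply]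
    rw [solutionOp_eq fL fR w f hz, dampedInflow_eq]
  · filter_upwards [hmem] with z hz
    simp only [Function.uncurry]
    rw [solutionOp_eq fL fR w f hz, dampedInflow_eq]
    refine (norm_add_le _ _).trans (add_le_add ?_ ?_)
    · rw [norm_mul, Real.norm_of_nonneg (r := damp w z.1 z.2) (Real.exp_pos _).le]
      exact mul_le_of_le_one_left (norm_nonneg _) (damp_le_one hw.le hz _)
    · rw [Real.norm_of_nonneg (gain_maxwellian_nonneg hw.le hJ _ _)]
      exact (gain_maxwellian_le hw hG hJ hz _).trans
        (mul_le_of_le_one_left (hG _) (scatter_le_one w _))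

/-- The first smallness condition fits the gain under the factor `2` in `a_u`; the second fits its
effect on the energy quotient into the gap between `λ` and `√λ`. -/
lemma solutionOp_mem_solutionSpace (hnonneg : 0 ≤ᵐ[volume] inflow fL fR)
    (hint : Integrable (inflow fL fR)) {l : ℝ} (ha : 0 < a) (hl1 : l < 1) (hw : 0 < w)
    (haw : a ≤ aLower fL fR w) (hl : ∀ x ∈ Icc (0 : ℝ) 1, lam fL fR w x ≤ l)
    (hG : ∀ q, 0 ≤ G q) (hGi : Integrable G)
    (hbound : ∀ h, Admissible a (aUpper fL fR) (Real.sqrt l) h →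
      ∀ q, 0 ≤ maxwellian h q ∧ maxwellian h q ≤ G q)
    (hsmall₁ : ∫ q, scatter w q * G q ≤ ∫ q, inflow fL fR q)
    (hsmall₂ : (∫ q, scatter w q * G q) / a ≤
      Real.sqrt (a / ∫ q, inflow fL fR q) * (1 - Real.sqrt l))
    (hf : f ∈ solutionSpace fL fR w) : solutionOp fL fR w f ∈ solutionSpace fL fR w := by
  have hadm := ae_admissible_of_mem_solutionSpace haw hl hf
  have hr : ∀ᵐ x ∂slab, energyRatio (f x) ∈ Ioo (0 : ℝ) 1 :=
    hadm.mono fun x H => H.energyRatio_mem ha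
  have hJ : ∀ᵐ y ∂slab, ∀ q, 0 ≤ maxwellian (f y) q ∧ maxwellian (f y) q ≤ G q :=
    hadm.mono fun y H => hbound _ H
  refine ⟨integrable_solutionOp hint hw hG hGi hf.1 hr hJ, ?_⟩
  filter_upwards [ae_slab_mem] with x hx
  have e : solutionOp fL fR w f x =
      fun q => dampedInflow fL fR w x q + gain w (fun y => maxwellian (f y)) x q :=
    funext fun q => solutionOp_eq fL fR w f hx q
  obtain ⟨hT, hTle⟩ := integrable_gain_maxwellian hw hG hGi hf.1 hr hJ hx
  have hT0 := gain_maxwellian_nonneg hw.le hJ x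
  have i1 := integrable_dampedInflow hint hw.le hx
  have n1 := dampedInflow_nonneg hnonneg w x
  have h2 := aLower_le_dampedInflow hnonneg hint hw.le hx
  have hratio := energyRatio_le_lam_add hnonneg hint hw.le ha haw hx hT hT0
  rw [e]
  set T := gain w (fun y => maxwellian (f y)) x
  have iΦ : Integrable fun q => dampedInflow fL fR w x q + T q := i1.add hT
  have nΦ : 0 ≤ᵐ[volume] fun q => dampedInflow fL fR w x q + T q := by
    filter_upwards [n1] with q hq
    exact add_nonneg hq (hT0 q)
  have h3 : aLower fL fR w ≤ ∫ q, (dampedInflow fL fR w x q + T q) * (1 / energy q ^ 2) :=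
    h2.trans (integral_mul_mono (integrable_mul_one_div_energy_sq i1)
      (integrable_mul_one_div_energy_sq iΦ)
      (Filter.Eventually.of_forall fun q => le_add_of_nonneg_right (hT0 q))
      fun q => (one_div_energy_sq_pos q).le)
  refine ⟨nΦ, h3, ?_, ?_⟩
  · rw [integral_add i1 hT, aUpper]
    have := integral_mono_ae i1 hint (dampedInflow_le hnonneg hw.le hx)
    linarith
  · rw [besselRatio_beta_of_energyRatio_mem
      (energyRatio_mem_Ioo iΦ nΦ ((ha.trans_le haw).trans_le h3))]
    have hlow := le_lam hnonneg hint hw.le ha haw hx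
    have hlam := hl x hx
    have hI : 0 < ∫ q, inflow fL fR q :=
      (((ha.trans_le haw).trans_le h2).trans_le (integral_one_div_energy_sq_le i1 n1)).trans_le
        ((integral_one_div_energy_le i1 n1).trans
          (integral_mono_ae i1 hint (dampedInflow_le hnonneg hw.le hx)))
    have hlam0 : 0 ≤ lam fL fR w x := (div_pos ha hI).le.trans hlow
    have s1 : Real.sqrt (a / ∫ q, inflow fL fR q) ≤ Real.sqrt (lam fL fR w x) :=
      Real.sqrt_le_sqrt hlow
    have s2 : Real.sqrt (lam fL fR w x) ≤ Real.sqrt l := Real.sqrt_le_sqrt hlam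
    have s3 : Real.sqrt l ≤ 1 := Real.sqrt_le_one.2 hl1.le
    have s4 := Real.sq_sqrt hlam0
    have s5 : (∫ q, T q) / a ≤ (∫ q, scatter w q * G q) / a := by gcongr
    have s6 : Real.sqrt (a / ∫ q, inflow fL fR q) * (1 - Real.sqrt l) ≤
        Real.sqrt (lam fL fR w x) * (1 - Real.sqrt (lam fL fR w x)) :=
      mul_le_mul s1 (by linarith) (by linarith) (Real.sqrt_nonneg _)
    -- The chain is `energyRatio ≤ λ + √λ (1 - √λ) = √λ`.
    nlinarith

/-! ### The contraction estimate -/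

lemma ofReal_integral_abs_sub {h k : Mom → ℝ} (hh : Integrable h) (hk : Integrable k) :
    ENNReal.ofReal (∫ q, |h q - k q|) = distL1 h k :=
  ofReal_integral_eq_lintegral_ofReal (hh.sub hk).abs
    (Filter.Eventually.of_forall fun _ => abs_nonneg _)

/-- The inflow terms cancel, and the gain sees its source only through almost every `y`. So an
essential supremum on the right controls every `x` on the left. -/
lemma distL1_solutionOp_le {l α : ℝ} (ha : 0 < a) (hw : 0 < w)
    (haw : a ≤ aLower fL fR w) (hl : ∀ x ∈ Icc (0 : ℝ) 1, lam fL fR w x ≤ l)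
    (hG : ∀ q, 0 ≤ G q) (hGi : Integrable G)
    (hbound : ∀ h, Admissible a (aUpper fL fR) (Real.sqrt l) h →
      ∀ q, 0 ≤ maxwellian h q ∧ maxwellian h q ≤ G q)
    (hlip : ∀ h k, Admissible a (aUpper fL fR) (Real.sqrt l) h →
      Admissible a (aUpper fL fR) (Real.sqrt l) k → ∀ q,
        |maxwellian h q - maxwellian k q| ≤ G q * ∫ p, |h p - k p|)
    (hα : 0 < α) (hsmall : ∫ q, scatter w q * G q ≤ α)
    (hf : f ∈ solutionSpace fL fR w) (hg : g ∈ solutionSpace fL fR w)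
    {x : ℝ} (hx : x ∈ Icc (0 : ℝ) 1) :
    distL1 (solutionOp fL fR w f x) (solutionOp fL fR w g x) ≤
      ENNReal.ofReal α * essSup (fun x => distL1 (f x) (g x)) slab := by
  set D := essSup (fun x => distL1 (f x) (g x)) slab with hD
  rcases eq_or_ne D ⊤ with htop | htop
  · rw [htop, ENNReal.mul_top (ENNReal.ofReal_pos.2 hα).ne']
    exact le_top
  have hadmf := ae_admissible_of_mem_solutionSpace haw hl hf
  have hadmg := ae_admissible_of_mem_solutionSpace haw hl hg
  have hle : ∀ᵐ y ∂slab, distL1 (f y) (g y) ≤ D := ae_le_essSup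
  have hd : ∀ᵐ y ∂slab, ∀ q, |maxwellian (f y) q - maxwellian (g y) q| ≤ G q * D.toReal := by
    filter_upwards [hadmf, hadmg, hle] with y F K hy q
    refine (hlip _ _ F K q).trans (mul_le_mul_of_nonneg_left ?_ (hG q))
    rw [← ofReal_integral_abs_sub F.integrable K.integrable] at hy
    exact (ENNReal.ofReal_le_iff_le_toReal htop).1 hy
  have hJ : ∀ {f : ℝ → Mom → ℝ},
      (∀ᵐ y ∂slab, Admissible a (aUpper fL fR) (Real.sqrt l) (f y)) → ∀ q,
      ∀ᵐ y ∂slab, |maxwellian (f y) q| ≤ G q := fun hadm q => by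
    filter_upwards [hadm] with y H
    rw [abs_of_nonneg (hbound _ H q).1]
    exact (hbound _ H q).2
  have hpt : ∀ q, |solutionOp fL fR w f x q - solutionOp fL fR w g x q| ≤
      scatter w q * G q * D.toReal := fun q => by
    rw [solutionOp_eq fL fR w f hx, solutionOp_eq fL fR w g hx, add_sub_add_left_eq_sub, mul_assoc]
    exact abs_gain_sub_le hw hx (mul_nonneg (hG q) ENNReal.toReal_nonneg)
      (aestronglyMeasurable_maxwellian hf.1 (hadmf.mono fun _ H => H.energyRatio_mem ha) q)
      (hJ hadmf q)
      (aestronglyMeasurable_maxwellian hg.1 (hadmg.mono fun _ H => H.energyRatio_mem ha) q)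
      (hJ hadmg q) (hd.mono fun _ hy => hy q)
  calc distL1 (solutionOp fL fR w f x) (solutionOp fL fR w g x)
      ≤ ∫⁻ q, ENNReal.ofReal (scatter w q * G q * D.toReal) :=
        lintegral_mono fun q => ENNReal.ofReal_le_ofReal (hpt q)
    _ = ENNReal.ofReal ((∫ q, scatter w q * G q) * D.toReal) := by
        rw [← integral_mul_const, ofReal_integral_eq_lintegral_ofReal
          ((integrable_scatter_mul hGi hw.le).mul_const _)
          (Filter.Eventually.of_forall fun q =>
            mul_nonneg (mul_nonneg (scatter_nonneg hw.le q) (hG q)) ENNReal.toReal_nonneg)]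
    _ ≤ ENNReal.ofReal (α * D.toReal) := ENNReal.ofReal_le_ofReal
        (mul_le_mul_of_nonneg_right hsmall ENNReal.toReal_nonneg)
    _ = ENNReal.ofReal α * D := by
        rw [ENNReal.ofReal_mul hα.le, ENNReal.ofReal_toReal htop]

end Source

end MarleBGK

/-- For nonnegative integrable inflow data with `a_l > 0` and all small collision frequencies `w`,
the solution operator is a contraction mapping on the solution space. On the left the supremum is
over every `x` in `[0, 1]`; on the right it is the essential supremum (the least one over all
representatives), so the same holds with `sup` or with `ess sup` on both sides. -/
theorem proposition4p4 (fL fR : MarleBGK.Mom → ℝ)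
    (hnonneg : ∀ᵐ q : MarleBGK.Mom, 0 ≤ MarleBGK.inflow fL fR q)
    (hint : MeasureTheory.Integrable (MarleBGK.inflow fL fR))
    (hal : ∀ w : ℝ, 0 < w → 0 < MarleBGK.aLower fL fR w) :
    ∃ ε : ℝ, 0 < ε ∧ ∀ w : ℝ, 0 < w → w < ε →
      Set.MapsTo (MarleBGK.solutionOp fL fR w)
        (MarleBGK.solutionSpace fL fR w) (MarleBGK.solutionSpace fL fR w) ∧
      ∃ α : ℝ, 0 < α ∧ α < 1 ∧
        ∀ f ∈ MarleBGK.solutionSpace fL fR w, ∀ g ∈ MarleBGK.solutionSpace fL fR w,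
          (⨆ x ∈ Set.Icc (0 : ℝ) 1,
              MarleBGK.distL1 (MarleBGK.solutionOp fL fR w f x)
                (MarleBGK.solutionOp fL fR w g x)) ≤
            ENNReal.ofReal α * essSup (fun x => MarleBGK.distL1 (f x) (g x)) MarleBGK.slab := by
  open MarleBGK in
  obtain ⟨l, hl0, hl1, hlam⟩ := exists_lam_le hnonneg hint hal
  -- The value of `a_l` at `w = 1` serves as the lower bound for every `w < 1`, which makes `c` and
  -- `C` independent of `w`.
  have ha := hal 1 one_pos
  have hI : 0 < ∫ q, inflow fL fR q := by
    have i1 := integrable_fullyDamped hint zero_le_one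
    have n1 := fullyDamped_nonneg hnonneg 1
    have h1 := integral_mono_ae i1 hint (show ∀ᵐ q, fullyDamped fL fR 1 q ≤ inflow fL fR q by
      filter_upwards [fullyDamped_le_dampedInflow hnonneg zero_le_one
        (left_mem_Icc.2 zero_le_one), dampedInflow_le hnonneg zero_le_one
        (left_mem_Icc.2 zero_le_one)] with q hq hq' using hq.trans hq')
    have h2 := (integral_one_div_energy_sq_le i1 n1).trans (integral_one_div_energy_le i1 n1)
    exact (ha.trans_le h2).trans_le h1
  have hs : Real.sqrt l < 1 := by
    rw [Real.sqrt_lt' one_pos]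
    simpa using hl1
  obtain ⟨c, hc, C, hC, hbound, hlip⟩ := exists_maxwellian_bounds (a := aLower fL fR 1)
    (A := aUpper fL fR) ha (mul_pos two_pos hI) hs
  have hG : ∀ q : Mom, 0 ≤ C * (energy q * Real.exp (-c * energy q)) := fun q =>
    mul_nonneg hC.le (mul_nonneg (energy_pos q).le (Real.exp_pos _).le)
  have hGi : Integrable fun q : Mom => C * (energy q * Real.exp (-c * energy q)) := by
    simpa using (integrable_energy_pow_mul_exp 1 hc).const_mul C
  have hκ := tendsto_integral_scatter_mul hGi
  have hδ : 0 < aLower fL fR 1 *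
      (Real.sqrt (aLower fL fR 1 / ∫ q, inflow fL fR q) * (1 - Real.sqrt l)) :=
    mul_pos ha (mul_pos (Real.sqrt_pos.2 (div_pos ha hI)) (by linarith))
  -- The gain mass is made small three times: for the mass bound, for the energy quotient, and for
  -- the contraction constant `1 / 2`. The interval `(0, 1)` secures `w ≤ 1`.
  have hev := (((hlam.and (hκ.eventually_le_const hI)).and (hκ.eventually_le_const hδ)).and
    (hκ.eventually_le_const one_half_pos)).and (Ioo_mem_nhdsGT (one_pos (α := ℝ)))
  obtain ⟨ε, hε, hsub⟩ := mem_nhdsGT_iff_exists_Ioo_subset.1 hev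
  refine ⟨ε, hε, fun w hw hwε => ?_⟩
  obtain ⟨⟨⟨⟨hl, h1⟩, h2⟩, h3⟩, h4⟩ := hsub ⟨hw, hwε⟩
  have haw := aLower_anti hnonneg hint hw.le h4.2.le
  refine ⟨fun f hf => solutionOp_mem_solutionSpace hnonneg hint ha hl1 hw haw hl hG hGi hbound h1
    ((div_le_iff₀' ha).2 h2) hf, 1 / 2, one_half_pos, one_half_lt_one, fun f hf g hg => ?_⟩
  exact iSup₂_le fun x hx => distL1_solutionOp_le ha hw haw hl hG hGi hbound hlip one_half_pos h3
    hf hg hx
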